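/- **Theorem 1.** Say that a graph $G$ contains a graph $H$ if some (not necessarily induced) subgraph of $G$ is isomorphic to $H$. For an integer $n\ge 1$, let $s(n)$ denote the minimum number of edges in an $n$-vertex graph that contains every $n$-vertex tree. Then $$s(n)\le \tfrac{14}{5}\,n\log_2 n+O(n),$$ that is, there is an absolute constant $C$ such that for every $n\ge 1$ there is a graph with exactly $n$ vertices and at most $\tfrac{14}{5}n\log_2 n+Cn$ edges that contains every tree with $n$ vertices. -/

import Mathlib

/-- A graph `G` is universal for a family `F` of graphs if it contains every member of `F`, i.e.
some (not necessarily induced) subgraph of `G` is isomorphic to it. -/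
def IsUniversalFor {V W : Type*} (G : SimpleGraph V) (F : Set (SimpleGraph W)) : Prop :=
  ∀ H ∈ F, H.IsContained G

/-- The family of `n`-vertex trees, on the vertex set `Fin n`; up to isomorphism these are all
trees with `n` vertices. -/
def treeFamily (n : ℕ) : Set (SimpleGraph (Fin n)) :=
  {T | T.IsTree}

/-- The numbers of edges of the `n`-vertex graphs that contain every `n`-vertex tree. -/
def universalEdgeCounts (n : ℕ) : Set ℕ :=
  {m | ∃ G : SimpleGraph (Fin n), IsUniversalFor G (treeFamily n) ∧ G.edgeSet.ncard = m}

/-- `s(n)`: the minimum number of edges in an `n`-vertex graph that contains every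
`n`-vertex tree. -/
noncomputable def minUniversalEdges (n : ℕ) : ℕ :=
  sInf (universalEdgeCounts n)

/-- The minimum defining `s(n)` is over a nonempty set: the complete graph is universal. -/
theorem universalEdgeCounts_nonempty (n : ℕ) : (universalEdgeCounts n).Nonempty :=
  ⟨_, ⊤, fun _ _ => SimpleGraph.IsContained.of_le le_top, rfl⟩

/-- `s(n)` is a genuine minimum: it is attained, and it is a lower bound. -/
theorem isLeast_minUniversalEdges (n : ℕ) :
    IsLeast (universalEdgeCounts n) (minUniversalEdges n) :=
  ⟨Nat.sInf_mem (universalEdgeCounts_nonempty n), fun _ hm => Nat.sInf_le hm⟩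

/-! Vertices are positions 1, …, n, and an odd multiple of 2^e is joined to a window of length about
(13/5 + 3)·2^e around it. There are about n/2^(e+1) such positions, so each of the log₂ n levels
costs (14/5)n edges, up to errors summing to O(n) (`card_coveredPairs_le`).

Universality is proved by recursive separation (`exists_embedding_of_isReady`). A piece F goes into
a block J of |F| free positions: a vertex x is placed at some p in J, and the pieces of F \ {x} go
into consecutive blocks of J \ {p}. Each piece has at most one neighbour of x, so the induction only
has to force one prescribed vertex to a position at least w; reflection gives upper bounds. Holes
left by earlier separators are multiples of a large power of two (`GapsDvd`), so there are few of
them and positions of low level remain free.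

Let 2·2^e < |J| ≤ 4·2^e. A free odd multiple of 2^e covers J unless J extends by more than about
(8/5)·2^e to both sides of an odd multiple z of 2^(e+1) (`exists_covers_or_bad`); even then z covers
J if it is free. A bushy piece uses such a covering position, and all its remaining pieces are
light. A piece that is not bushy is cut at a centroid, which leaves one or two heavy pieces. These
go to the ends of the block, so that x needs to reach only part of an end block, the prescribed
vertex of that end piece being pushed inwards. The separator must not occupy the z of a bushy heavy
piece; if both heavy pieces forbid both candidates, a position of the next lower level between them
works (`hasPlacement_of_both`). -/

/-! ### Splitting a forest at a centroid. -/

/-- The graph `T` restricted to edges with both ends in `S`. -/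
def edgesWithin {V : Type*} (T : SimpleGraph V) (S : Finset V) : SimpleGraph V where
  Adj u v := T.Adj u v ∧ u ∈ S ∧ v ∈ S
  symm := ⟨fun _ _ h => ⟨h.1.symm, h.2.2, h.2.1⟩⟩
  loopless := ⟨fun _ h => h.1.ne rfl⟩

/-- `P` is a partition of `F \ {x}` into nonempty sets without edges of `T` between them, each of
which contains at most one neighbour of `x`. -/
structure IsSplit {V : Type*} [DecidableEq V] (T : SimpleGraph V) (F : Finset V) (x : V)
    (P : Finset (Finset V)) : Prop where
  nonempty : ∀ C ∈ P, C.Nonempty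
  disjoint : ∀ C ∈ P, ∀ D ∈ P, ∀ u ∈ C, u ∈ D → C = D
  subset : ∀ C ∈ P, ∀ u ∈ C, u ∈ F ∧ u ≠ x
  cover : ∀ u ∈ F, u ≠ x → ∃ C ∈ P, u ∈ C
  separated : ∀ C ∈ P, ∀ D ∈ P, ∀ u ∈ C, ∀ v ∈ D, T.Adj u v → C = D
  unique : ∀ C ∈ P, ∀ u ∈ C, ∀ v ∈ C, T.Adj x u → T.Adj x v → u = v

section Splitting

variable {V : Type*} {T : SimpleGraph V}

theorem edgesWithin_le (S : Finset V) : edgesWithin T S ≤ T := fun _ _ h => h.1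

theorem mem_of_mem_support_edgesWithin {S : Finset V} {u v : V} (w : (edgesWithin T S).Walk u v)
    (hu : u ∈ S) : ∀ z ∈ w.support, z ∈ S := by
  induction w with
  | nil => simpa using hu
  | cons h w ih =>
    intro z hz
    rw [SimpleGraph.Walk.support_cons, List.mem_cons] at hz
    rcases hz with rfl | hz
    · exact hu
    · exact ih h.2.2 z hz

/-- Otherwise the path from `x` through `y` inside `S` and the edge from `x` to `z` would be two
different paths in a forest. -/
theorem neighbor_unique_of_reachable (hT : T.IsAcyclic) {S : Finset V} {x y z : V} (hx : x ∉ S)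
    (hy : y ∈ S) (hxy : T.Adj x y) (hxz : T.Adj x z) (h : (edgesWithin T S).Reachable y z) :
    y = z := by
  classical
  obtain ⟨w⟩ := h
  have hs := mem_of_mem_support_edgesWithin w.bypass hy
  have hp : (w.bypass.mapLe (edgesWithin_le S)).IsPath :=
    (SimpleGraph.Walk.isPath_mapLe (edgesWithin_le S)).2 w.bypass_isPath
  have hq : (SimpleGraph.Walk.cons hxy (w.bypass.mapLe (edgesWithin_le S))).IsPath := by
    rw [SimpleGraph.Walk.cons_isPath_iff]
    refine ⟨hp, fun hmem => hx (hs x ?_)⟩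
    simpa using hmem
  have hr : (SimpleGraph.Walk.cons hxz SimpleGraph.Walk.nil).IsPath := by
    simp [SimpleGraph.Walk.cons_isPath_iff, hxz.ne]
  have := (SimpleGraph.isAcyclic_iff_subsingleton_path.1 hT x z).elim ⟨_, hq⟩ ⟨_, hr⟩
  have hsup := congrArg (fun p : T.Path x z => p.1.snd) this
  simpa using hsup

open Classical in
/-- The vertices reachable from `u` inside `S`. -/
noncomputable def pieceOf (T : SimpleGraph V) (S : Finset V) (u : V) : Finset V :=
  S.filter fun v => (edgesWithin T S).Reachable u v

theorem mem_pieceOf {S : Finset V} {u v : V} :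
    v ∈ pieceOf T S u ↔ v ∈ S ∧ (edgesWithin T S).Reachable u v := by
  simp [pieceOf]

theorem pieceOf_eq {S : Finset V} {u v : V} (h : (edgesWithin T S).Reachable u v) :
    pieceOf T S u = pieceOf T S v := by
  ext z
  simp only [mem_pieceOf]
  exact ⟨fun hz => ⟨hz.1, h.symm.trans hz.2⟩, fun hz => ⟨hz.1, h.trans hz.2⟩⟩

variable [DecidableEq V]

theorem isSplit_image_pieceOf (hT : T.IsAcyclic) (F : Finset V) (x : V) :
    IsSplit T F x ((F.erase x).image (pieceOf T (F.erase x))) := by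
  have key : ∀ C ∈ (F.erase x).image (pieceOf T (F.erase x)), ∀ u ∈ C,
      C = pieceOf T (F.erase x) u := by
    intro C hC u hu
    obtain ⟨v, -, rfl⟩ := Finset.mem_image.1 hC
    exact pieceOf_eq (mem_pieceOf.1 hu).2
  have sub : ∀ C ∈ (F.erase x).image (pieceOf T (F.erase x)), ∀ u ∈ C, u ∈ F.erase x := by
    intro C hC u hu
    obtain ⟨v, -, rfl⟩ := Finset.mem_image.1 hC
    exact (mem_pieceOf.1 hu).1
  refine ⟨?_, ?_, ?_, ?_, ?_, ?_⟩
  · intro C hC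
    obtain ⟨v, hv, rfl⟩ := Finset.mem_image.1 hC
    exact ⟨v, mem_pieceOf.2 ⟨hv, SimpleGraph.Reachable.refl _⟩⟩
  · intro C hC D hD u hu hu'
    rw [key C hC u hu, key D hD u hu']
  · intro C hC u hu
    have := sub C hC u hu
    exact ⟨(Finset.mem_erase.1 this).2, (Finset.mem_erase.1 this).1⟩
  · intro u hu hux
    have hu' : u ∈ F.erase x := Finset.mem_erase.2 ⟨hux, hu⟩
    exact ⟨_, Finset.mem_image_of_mem _ hu', mem_pieceOf.2 ⟨hu', SimpleGraph.Reachable.refl _⟩⟩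
  · intro C hC D hD u hu v hv huv
    rw [key C hC u hu, key D hD v hv]
    exact pieceOf_eq (SimpleGraph.Adj.reachable ⟨huv, sub C hC u hu, sub D hD v hv⟩)
  · intro C hC u hu v hv hxu hxv
    have hv' := hv
    rw [key C hC u hu, mem_pieceOf] at hv'
    exact neighbor_unique_of_reachable hT (by simp) (sub C hC u hu) hxu hxv hv'.2

/-- Every finite vertex set of a forest has a vertex whose removal leaves only pieces of at most
half the size. -/
theorem exists_centroid (hT : T.IsAcyclic) (F : Finset V) (hF : F.Nonempty) :
    ∃ x ∈ F, ∃ P, IsSplit T F x P ∧ ∀ C ∈ P, 2 * C.card ≤ F.card := by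
  by_contra! hcon
  have hbig : ∀ x ∈ F, ∃ u ∈ F.erase x, F.card < 2 * (pieceOf T (F.erase x) u).card := by
    intro x hx
    obtain ⟨C, hC, hlt⟩ := hcon x hx _ (isSplit_image_pieceOf hT F x)
    obtain ⟨u, hu, rfl⟩ := Finset.mem_image.1 hC
    exact ⟨u, hu, hlt⟩
  -- Extremal choice: among all pieces with more than half of `F`, over all deleted vertices, take a
  -- smallest one. Moving the deleted vertex into it yields a smaller one.
  let A := (F ×ˢ F).filter fun q => q.2 ∈ F.erase q.1 ∧
    F.card < 2 * (pieceOf T (F.erase q.1) q.2).card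
  have hA : A.Nonempty := by
    obtain ⟨x, hx⟩ := hF
    obtain ⟨u, hu, hlt⟩ := hbig x hx
    exact ⟨(x, u), by simp only [A, Finset.mem_filter, Finset.mem_product]
                      exact ⟨⟨hx, Finset.mem_of_mem_erase hu⟩, hu, hlt⟩⟩
  obtain ⟨⟨x, u⟩, hxu, hmin⟩ :=
    Finset.exists_min_image A (fun q => (pieceOf T (F.erase q.1) q.2).card) hA
  simp only [A, Finset.mem_filter, Finset.mem_product] at hxu
  obtain ⟨⟨hx, -⟩, hu, hlt⟩ := hxu
  have hsplit := isSplit_image_pieceOf hT F x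
  have hCmem : pieceOf T (F.erase x) u ∈ (F.erase x).image (pieceOf T (F.erase x)) :=
    Finset.mem_image_of_mem _ hu
  obtain ⟨y, hy, hyx⟩ : ∃ y ∈ pieceOf T (F.erase x) u,
      ∀ z ∈ pieceOf T (F.erase x) u, T.Adj x z → z = y := by
    by_cases h : ∃ y ∈ pieceOf T (F.erase x) u, T.Adj x y
    · obtain ⟨y, hy, hxy⟩ := h
      exact ⟨y, hy, fun z hz hxz => hsplit.unique _ hCmem z hz y hy hxz hxy⟩
    · push Not at h
      exact ⟨u, mem_pieceOf.2 ⟨hu, SimpleGraph.Reachable.refl _⟩,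
        fun z hz hxz => (h z hz hxz).elim⟩
  have hyF : y ∈ F := (hsplit.subset _ hCmem y hy).1
  obtain ⟨u', hu', hlt'⟩ := hbig y hyF
  have hle := hmin (y, u') (by
    simp only [A, Finset.mem_filter, Finset.mem_product]
    exact ⟨⟨hyF, Finset.mem_of_mem_erase hu'⟩, hu', hlt'⟩)
  obtain ⟨w, hw⟩ : (pieceOf T (F.erase x) u ∩ pieceOf T (F.erase y) u').Nonempty := by
    rw [Finset.nonempty_iff_ne_empty]
    intro h0
    have h1 := Finset.card_union_add_card_inter (pieceOf T (F.erase x) u) (pieceOf T (F.erase y) u')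
    rw [h0, Finset.card_empty] at h1
    have h2 : (pieceOf T (F.erase x) u ∪ pieceOf T (F.erase y) u').card ≤ F.card := by
      apply Finset.card_le_card
      intro z hz
      rcases Finset.mem_union.1 hz with hz | hz
      · exact Finset.mem_of_mem_erase (mem_pieceOf.1 hz).1
      · exact Finset.mem_of_mem_erase (mem_pieceOf.1 hz).1
    omega
  rw [Finset.mem_inter] at hw
  -- A walk can leave the piece of `u` only through `x`, hence from `y`, the only possible neighbour
  -- of `x` there; but `y` is deleted.
  have closed : ∀ z z', (edgesWithin T (F.erase y)).Walk z z' → z ∈ pieceOf T (F.erase x) u →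
      z' ∈ pieceOf T (F.erase x) u := by
    intro z z' p
    induction p with
    | nil => exact id
    | @cons a b c h p ih =>
      intro ha
      apply ih
      have hbx : b ≠ x := by
        rintro rfl
        have hay := hyx _ ha h.1.symm
        have := h.2.1
        rw [hay] at this
        simp at this
      have hb : b ∈ F.erase x := Finset.mem_erase.2 ⟨hbx, Finset.mem_of_mem_erase h.2.2⟩
      have ha' := mem_pieceOf.1 ha
      exact mem_pieceOf.2 ⟨hb, ha'.2.trans (SimpleGraph.Adj.reachable ⟨h.1, ha'.1, hb⟩)⟩
  have hsub : pieceOf T (F.erase y) u' ⊆ (pieceOf T (F.erase x) u).erase y := by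
    intro z hz
    have hz' := mem_pieceOf.1 hz
    obtain ⟨p⟩ := (mem_pieceOf.1 hw.2).2.symm.trans hz'.2
    exact Finset.mem_erase.2 ⟨(Finset.mem_erase.1 hz'.1).1, closed _ _ p hw.1⟩
  have hc := Finset.card_le_card hsub
  rw [Finset.card_erase_of_mem hy] at hc
  have hpos : 0 < (pieceOf T (F.erase x) u).card := Finset.card_pos.2 ⟨y, hy⟩
  simp only at hle
  omega

theorem IsSplit.sum_card {F : Finset V} {x : V} {P : Finset (Finset V)} (h : IsSplit T F x P) :
    ∑ C ∈ P, C.card = (F.erase x).card := by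
  have : F.erase x = P.biUnion id := by
    ext u
    simp only [Finset.mem_erase, Finset.mem_biUnion, id]
    constructor
    · rintro ⟨h1, h2⟩
      exact h.cover u h2 h1
    · rintro ⟨C, hC, hu⟩
      exact (h.subset C hC u hu).symm
  rw [this, Finset.card_biUnion]
  · rfl
  · intro C hC D hD hCD
    rw [Function.onFun, Finset.disjoint_left]
    exact fun u hu hu' => hCD (h.disjoint C hC D hD u hu hu')

/-- Some vertex of `F` splits `F` into pieces of size at most `8/5 * 2 ^ e`. -/
def IsBushy (T : SimpleGraph V) (F : Finset V) (e : ℕ) : Prop :=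
  ∃ x ∈ F, ∃ P, IsSplit T F x P ∧ ∀ C ∈ P, 5 * C.card ≤ 8 * 2 ^ e

end Splitting

/-! ### Windows, and blocks with sparse holes. -/

/-- The window of a position: a position `p = (2 * k + 1) * 2 ^ e` covers all positions at distance
at most `13 / 5 * 2 ^ e + 100`, and at distance at most `3 * 2 ^ e + 100` on the side where the
nearest multiple of `2 ^ (e + 1)` is a multiple of `2 ^ (e + 2)`. -/
def Covers (p y : ℤ) : Prop :=
  p = 0 ∨ ∃ (e : ℕ) (k : ℤ), p = (2 * k + 1) * 2 ^ e ∧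
    ((5 * (y - p) ≤ 13 * 2 ^ e + 500 ∧ 5 * (p - y) ≤ 13 * 2 ^ e + 500) ∨
      (Odd k ∧ p ≤ y ∧ y ≤ p + 3 * 2 ^ e + 100) ∨ (Even k ∧ y ≤ p ∧ p ≤ y + 3 * 2 ^ e + 100))

theorem covers_neg_neg {p y : ℤ} (h : Covers p y) : Covers (-p) (-y) := by
  rcases h with rfl | ⟨e, k, rfl, h⟩
  · exact Or.inl rfl
  · refine Or.inr ⟨e, -k - 1, by ring, ?_⟩
    rcases h with h | ⟨hk, h1, h2⟩ | ⟨hk, h1, h2⟩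
    · left; constructor <;> linarith [h.1, h.2]
    · right; right
      refine ⟨?_, by linarith, by linarith⟩
      obtain ⟨m, rfl⟩ := hk
      exact ⟨-m - 1, by ring⟩
    · right; left
      refine ⟨?_, by linarith, by linarith⟩
      obtain ⟨m, rfl⟩ := hk
      exact ⟨-m - 1, by ring⟩

/-- Windows grow with the power of two in `p`, so a lower bound for that power suffices. The clause
`p = 0` of `Covers` removes the exception; 0 is never a vertex. -/
theorem covers_of_dvd {p y : ℤ} {j : ℕ} (hp : (2 : ℤ) ^ j ∣ p)
    (h1 : 5 * (y - p) ≤ 13 * 2 ^ j + 500) (h2 : 5 * (p - y) ≤ 13 * 2 ^ j + 500) : Covers p y := by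
  by_cases h0 : p = 0
  · exact Or.inl h0
  · right
    obtain ⟨c, hc, hc2⟩ := FiniteMultiplicity.exists_eq_pow_mul_and_not_dvd
      (Int.finiteMultiplicity_iff.2 ⟨by decide, h0⟩ : FiniteMultiplicity (2 : ℤ) p)
    have hje : j ≤ multiplicity 2 p := (Int.finiteMultiplicity_iff.2
      ⟨by decide, h0⟩ : FiniteMultiplicity (2 : ℤ) p).le_multiplicity_of_pow_dvd hp
    obtain ⟨k, hk⟩ := Int.not_even_iff_odd.1 (mt even_iff_two_dvd.1 hc2)
    have hpow : (2 : ℤ) ^ j ≤ 2 ^ multiplicity 2 p := pow_le_pow_right₀ (by norm_num) hje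
    refine ⟨multiplicity 2 p, k, ?_, Or.inl ⟨by linarith, by linarith⟩⟩
    rw [← hk, mul_comm]
    exact hc

/-- Every integer between elements of `J` which is not in `J` is a multiple of `d`. -/
def GapsDvd (d : ℤ) (J : Finset ℤ) : Prop :=
  ∀ lo ∈ J, ∀ hi ∈ J, ∀ z, lo ≤ z → z ≤ hi → z ∉ J → d ∣ z

theorem GapsDvd.mono {d d' : ℤ} {J : Finset ℤ} (h : GapsDvd d J) (hd : d' ∣ d) : GapsDvd d' J :=
  fun lo hlo hi hhi z h1 h2 h3 => hd.trans (h lo hlo hi hhi z h1 h2 h3)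

theorem exists_hull_length_le {d : ℤ} {J : Finset ℤ} (hd : 0 < d) (h : GapsDvd d J) {lo hi : ℤ}
    (hlo : lo ∈ J) (hhi : hi ∈ J) (hle : lo ≤ hi) :
    ∃ m : ℤ, 0 ≤ m ∧ hi - lo + 1 ≤ J.card + m ∧ (m = 0 ∨ d * (m - 1) ≤ hi - lo) := by
  set A := hi / d
  set B := -((-lo) / d)
  have hA : d * A ≤ hi := Int.mul_ediv_self_le hd.ne'
  have hB : lo ≤ d * B := by
    have := Int.mul_ediv_self_le (x := -lo) hd.ne'
    simp only [B]; linarith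
  have hsub : Finset.Icc lo hi ⊆ J ∪ (Finset.Icc B A).image (fun q => d * q) := by
    intro z hz
    rw [Finset.mem_Icc] at hz
    rw [Finset.mem_union]
    by_cases hzJ : z ∈ J
    · exact Or.inl hzJ
    · right
      obtain ⟨q, rfl⟩ := h lo hlo hi hhi z hz.1 hz.2 hzJ
      refine Finset.mem_image.2 ⟨q, Finset.mem_Icc.2 ⟨?_, ?_⟩, rfl⟩
      · simp only [B]
        have : -q ≤ (-lo) / d := by
          rw [Int.le_ediv_iff_mul_le hd]; linarith
        linarith
      · rw [Int.le_ediv_iff_mul_le hd]; linarith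
  have hc := (Finset.card_le_card hsub).trans ((Finset.card_union_le _ _).trans
    (Nat.add_le_add_left Finset.card_image_le _))
  rw [Int.card_Icc, Int.card_Icc] at hc
  refine ⟨max (A - B + 1) 0, le_max_right _ _, by omega, ?_⟩
  rcases le_total (A - B + 1) 0 with h0 | h0
  · left; omega
  · right
    rw [max_eq_left h0]
    linarith

/-- With m holes, d(m - 1) is at most the length of the hull, hence at most 4d + m - 1; this forces
m ≤ 5 when d ≥ 8. -/
theorem hull_length_le {d : ℤ} {J : Finset ℤ} (hd : 8 ≤ d) (h : GapsDvd d J)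
    (hJ : (J.card : ℤ) ≤ 4 * d) {lo hi : ℤ} (hlo : lo ∈ J) (hhi : hi ∈ J) :
    hi - lo + 1 ≤ J.card + 5 := by
  rcases lt_or_ge hi lo with hlt | hle
  · omega
  obtain ⟨m, h0, h1, h2⟩ := exists_hull_length_le (by omega) h hlo hhi hle
  by_contra hcon
  rcases h2 with rfl | h2
  · omega
  · have h5 : 5 ≤ m - 1 := by omega
    nlinarith

theorem hull_length_le_of_card_le {d : ℤ} {J : Finset ℤ} (hd : 8 ≤ d) (h : GapsDvd d J)
    (hJ : J.card ≤ 32) {lo hi : ℤ} (hlo : lo ∈ J) (hhi : hi ∈ J) : hi - lo ≤ 100 :=  by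
  have := hull_length_le hd h (by have : (J.card : ℤ) ≤ 32 := by exact_mod_cast hJ
                                  omega) hlo hhi
  omega

theorem card_le_of_mem_hull {J : Finset ℤ} {a b : ℤ} (h : ∀ y ∈ J, a ≤ y ∧ y ≤ b) (hab : a ≤ b + 1) :
    (J.card : ℤ) ≤ b - a + 1 := by
  have := Finset.card_le_card (fun y hy => Finset.mem_Icc.2 (h y hy) : J ⊆ Finset.Icc a b)
  rw [Int.card_Icc] at this
  omega

theorem exists_odd_multiple_ge {h : ℤ} (hh : 0 < h) (a : ℤ) :
    ∃ k : ℤ, a ≤ (2 * k + 1) * h ∧ (2 * k + 1) * h < a + 2 * h := by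
  refine ⟨-((h - a) / (2 * h)), ?_, ?_⟩
  · have := Int.mul_ediv_self_le (x := h - a) (k := 2 * h) (by omega)
    linarith
  · have := Int.lt_mul_ediv_self_add (x := h - a) (k := 2 * h) (by omega)
    linarith

/-- Used to see that odd multiples of `h` are free when all holes are multiples of `2 * h`. -/
theorem not_dvd_odd_mul {k h : ℤ} (hh : 0 < h) : ¬ (2 * h) ∣ (2 * k + 1) * h := by
  rintro ⟨q, hq⟩
  have : (2 * k + 1 - 2 * q) * h = 0 := by linarith
  rcases mul_eq_zero.1 this with h1 | h1 <;> omega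

/-- A block of size between `2 ^ (e + 1)` and `2 ^ (e + 2)` is covered by one of its odd multiples
of `2 ^ e`, unless it extends far to both sides of an odd multiple of `2 ^ (e + 1)`. -/
theorem exists_covers_or_bad {e : ℕ} (he : 3 ≤ e) {J : Finset ℤ} (hJ : 2 * 2 ^ e < J.card)
    (hJ' : J.card ≤ 4 * 2 ^ e) (hg : GapsDvd (2 ^ (e + 1)) J) :
    (∃ k : ℤ, (2 * k + 1) * 2 ^ e ∈ J ∧ ∀ y ∈ J, Covers ((2 * k + 1) * 2 ^ e) y) ∨
    ∃ k : ℤ, ∃ lo ∈ J, ∃ hi ∈ J, 5 * lo + 8 * 2 ^ e + 500 < 5 * ((2 * k + 1) * 2 ^ (e + 1)) ∧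
      5 * ((2 * k + 1) * 2 ^ (e + 1)) + 8 * 2 ^ e + 500 < 5 * hi := by
  have hne : J.Nonempty := Finset.card_pos.1 (by omega)
  obtain ⟨a, ha, hamin⟩ := Finset.exists_min_image J id hne
  obtain ⟨b, hb, hbmax⟩ := Finset.exists_max_image J id hne
  simp only [id] at hamin hbmax
  have hH8 : (8 : ℤ) ≤ 2 ^ e := by
    calc (8 : ℤ) = 2 ^ 3 := by norm_num
      _ ≤ 2 ^ e := pow_le_pow_right₀ (by norm_num) he
  have hlen := hull_length_le (d := 2 ^ (e + 1)) (by rw [pow_succ]; linarith) hg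
    (by rw [pow_succ]; have : (J.card : ℤ) ≤ 4 * 2 ^ e := by exact_mod_cast hJ'
        linarith) ha hb
  have hlen' := card_le_of_mem_hull (fun y hy => ⟨hamin y hy, hbmax y hy⟩)
    (by linarith [hamin b hb])
  have hJz : (2 : ℤ) * 2 ^ e < J.card := by exact_mod_cast hJ
  have hJz' : (J.card : ℤ) ≤ 4 * 2 ^ e := by exact_mod_cast hJ'
  have hdvd : ∀ k : ℤ, (2 : ℤ) ^ e ∣ (2 * k + 1) * 2 ^ e := fun k => Dvd.intro_left _ rfl
  have hmem : ∀ k : ℤ, a ≤ (2 * k + 1) * 2 ^ e → (2 * k + 1) * 2 ^ e ≤ b →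
      (2 * k + 1) * 2 ^ e ∈ J := by
    intro k h1 h2
    by_contra hn
    have := hg a ha b hb _ h1 h2 hn
    rw [pow_succ, mul_comm ((2 : ℤ) ^ e)] at this
    exact not_dvd_odd_mul (by linarith) this
  have hpow : (2 : ℤ) ^ (e + 1) = 2 * 2 ^ e := by ring
  rw [hpow]
  obtain ⟨k, hk1, hk2⟩ := exists_odd_multiple_ge (h := 2 ^ e) (by linarith) a
  have hcov : ∀ k : ℤ, ∀ y ∈ J, 5 * (b - (2 * k + 1) * 2 ^ e) ≤ 13 * 2 ^ e + 500 →
      5 * ((2 * k + 1) * 2 ^ e - a) ≤ 13 * 2 ^ e + 500 → Covers ((2 * k + 1) * 2 ^ e) y := by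
    intro k y hy h1 h2
    exact covers_of_dvd (hdvd k) (by linarith [hbmax y hy]) (by linarith [hamin y hy])
  have hcovR : ∀ k : ℤ, Odd k → ∀ y ∈ J, b - (2 * k + 1) * 2 ^ e ≤ 3 * 2 ^ e + 100 →
      5 * ((2 * k + 1) * 2 ^ e - a) ≤ 13 * 2 ^ e + 500 → Covers ((2 * k + 1) * 2 ^ e) y := by
    intro k hk y hy h1 h2
    refine Or.inr ⟨e, k, rfl, ?_⟩
    rcases le_total ((2 * k + 1) * 2 ^ e) y with h | h
    · exact Or.inr (Or.inl ⟨hk, h, by linarith [hbmax y hy]⟩)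
    · exact Or.inl ⟨by linarith, by linarith [hamin y hy]⟩
  have hcovL : ∀ k : ℤ, Even k → ∀ y ∈ J, 5 * (b - (2 * k + 1) * 2 ^ e) ≤ 13 * 2 ^ e + 500 →
      (2 * k + 1) * 2 ^ e - a ≤ 3 * 2 ^ e + 100 → Covers ((2 * k + 1) * 2 ^ e) y := by
    intro k hk y hy h1 h2
    refine Or.inr ⟨e, k, rfl, ?_⟩
    rcases le_total y ((2 * k + 1) * 2 ^ e) with h | h
    · exact Or.inr (Or.inr ⟨hk, h, by linarith [hamin y hy]⟩)
    · exact Or.inl ⟨by linarith [hbmax y hy], by linarith⟩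
  set H : ℤ := 2 ^ e
  have e1 : (2 * (k + 1) + 1) * H = (2 * k + 1) * H + 2 * H := by ring
  have e2 : (2 * (k + 2) + 1) * H = (2 * k + 1) * H + 4 * H := by ring
  -- The hull has length about 4H at most and candidates are 2H apart. With one candidate, or with
  -- three, a central one covers the block; two candidates are the critical case.
  rcases le_or_gt ((2 * (k + 1) + 1) * H) b with hq2 | hq2
  · rcases le_or_gt ((2 * (k + 2) + 1) * H) b with hq3 | hq3
    · left
      exact ⟨k + 1, hmem _ (by linarith) hq2, fun y hy => hcov _ y hy (by linarith) (by linarith)⟩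
    · by_cases hA : 5 * (b - (2 * k + 1) * H) ≤ 13 * H + 500
      · left
        exact ⟨k, hmem _ hk1 (by linarith), fun y hy => hcov _ y hy hA (by linarith)⟩
      by_cases hB : 5 * ((2 * (k + 1) + 1) * H - a) ≤ 13 * H + 500
      · left
        exact ⟨k + 1, hmem _ (by linarith) hq2, fun y hy => hcov _ y hy (by linarith) hB⟩
      -- Both ends are now more than 8H/5 + 100 from the midpoint of the two candidates. For `k`
      -- even the midpoint is an odd multiple of 2H, the bad case. For `k` odd both long sides of
      -- the windows point to the midpoint; the two required reaches add up to at most 6H + 5, so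
      -- one is at most 3H + 100.
      rcases Int.even_or_odd k with hk | hk
      · right
        obtain ⟨m, hm⟩ := hk
        have e3 : (2 * m + 1) * (2 * H) = (2 * k + 1) * H + H := by rw [hm]; ring
        refine ⟨m, a, ha, b, hb, ?_, ?_⟩ <;> linarith
      · left
        rcases le_total (b - (2 * k + 1) * H) (3 * H + 100) with hC | hC
        · exact ⟨k, hmem _ hk1 (by linarith), fun y hy => hcovR _ hk y hy hC (by linarith)⟩
        · exact ⟨k + 1, hmem _ (by linarith) hq2, fun y hy => hcovL _ hk.add_one y hy
            (by linarith) (by linarith)⟩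
  · left
    exact ⟨k, hmem _ hk1 (by linarith), fun y hy => hcov _ y hy (by linarith) (by linarith)⟩

/-! ### Arranging pieces in consecutive blocks. -/

theorem exists_initial_segment (S : Finset ℤ) {k : ℕ} (hk : k ≤ S.card) :
    ∃ A ⊆ S, A.card = k ∧ ∀ u ∈ A, ∀ v ∈ S, v ∉ A → u < v := by
  induction k with
  | zero => exact ⟨∅, by simp, by simp, by simp⟩
  | succ k ih =>
    obtain ⟨A, hA, hc, hlt⟩ := ih (by omega)
    have hne : (S \ A).Nonempty := by
      rw [← Finset.card_pos, Finset.card_sdiff_of_subset hA]; omega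
    obtain ⟨m, hm, hmin⟩ := Finset.exists_min_image (S \ A) id hne
    rw [Finset.mem_sdiff] at hm
    refine ⟨insert m A, Finset.insert_subset hm.1 hA, by
      rw [Finset.card_insert_of_notMem hm.2, hc], ?_⟩
    intro u hu v hv hvA
    rw [Finset.mem_insert, not_or] at hvA
    rcases Finset.mem_insert.1 hu with rfl | hu
    · exact lt_of_le_of_ne (hmin v (Finset.mem_sdiff.2 ⟨hv, hvA.2⟩)) (Ne.symm hvA.1)
    · exact hlt u hu v hv hvA.2

/-- The sets `blk C`, for `C ∈ P`, are consecutive blocks of `S` of the sizes of the sets `C`,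
ordered from left to right by `key`. -/
structure IsArrangement {V : Type*} (P : Finset (Finset V)) (S : Finset ℤ) (key : Finset V → ℕ)
    (blk : Finset V → Finset ℤ) : Prop where
  subset : ∀ C ∈ P, blk C ⊆ S
  card : ∀ C ∈ P, (blk C).card = C.card
  convex : ∀ C ∈ P, ∀ lo ∈ blk C, ∀ hi ∈ blk C, ∀ z ∈ S, lo ≤ z → z ≤ hi → z ∈ blk C
  cover : ∀ s ∈ S, ∃ C ∈ P, s ∈ blk C
  disjoint : ∀ C ∈ P, ∀ D ∈ P, ∀ s ∈ blk C, s ∈ blk D → C = D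
  ordered : ∀ C ∈ P, ∀ D ∈ P, key C < key D → ∀ u ∈ blk C, ∀ v ∈ blk D, u < v

theorem exists_arrangement {V : Type*} [DecidableEq V] (key : Finset V → ℕ)
    (P : Finset (Finset V)) (S : Finset ℤ) (h : ∑ C ∈ P, C.card = S.card) :
    ∃ blk, IsArrangement P S key blk := by
  induction hn : P.card generalizing P S with
  | zero =>
    obtain rfl := Finset.card_eq_zero.1 hn
    obtain rfl := Finset.card_eq_zero.1 (show S.card = 0 by simpa using h.symm)
    exact ⟨fun _ => ∅, by constructor <;> simp⟩
  | succ n ih =>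
    obtain ⟨C, hC, hmin⟩ := Finset.exists_min_image P key (Finset.card_pos.1 (by omega))
    have hsum := Finset.add_sum_erase P Finset.card hC
    obtain ⟨A, hA, hAc, hAlt⟩ := exists_initial_segment S (k := C.card) (by omega)
    obtain ⟨blk, hb⟩ := ih (P.erase C) (S \ A)
      (by rw [Finset.card_sdiff_of_subset hA]; omega)
      (by rw [Finset.card_erase_of_mem hC]; omega)
    have hmem : ∀ D ∈ P, D ≠ C → D ∈ P.erase C := fun D hD h => Finset.mem_erase.2 ⟨h, hD⟩
    have hrest : ∀ D ∈ P, D ≠ C → ∀ s ∈ blk D, s ∈ S ∧ s ∉ A := fun D hD h s hs =>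
      Finset.mem_sdiff.1 (hb.subset D (hmem D hD h) hs)
    refine ⟨Function.update blk C A, ?_, ?_, ?_, ?_, ?_, ?_⟩
    · intro D hD
      by_cases hDC : D = C
      · subst hDC; simpa using hA
      · rw [Function.update_of_ne hDC]
        exact fun s hs => (hrest D hD hDC s hs).1
    · intro D hD
      by_cases hDC : D = C
      · subst hDC; simpa using hAc
      · rw [Function.update_of_ne hDC]
        exact hb.card D (hmem D hD hDC)
    · intro D hD
      by_cases hDC : D = C
      · subst hDC
        rw [Function.update_self]
        intro lo _ hi hhi z hz _ hzhi
        by_contra hzA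
        exact absurd (hAlt hi hhi z hz hzA) (by omega)
      · rw [Function.update_of_ne hDC]
        intro lo hlo hi hhi z hz h1 h2
        refine hb.convex D (hmem D hD hDC) lo hlo hi hhi z (Finset.mem_sdiff.2 ⟨hz, ?_⟩) h1 h2
        intro hzA
        have := hrest D hD hDC lo hlo
        exact absurd (hAlt z hzA lo this.1 this.2) (by omega)
    · intro s hs
      by_cases hsA : s ∈ A
      · exact ⟨C, hC, by simpa using hsA⟩
      · obtain ⟨D, hD, hsD⟩ := hb.cover s (Finset.mem_sdiff.2 ⟨hs, hsA⟩)
        rw [Finset.mem_erase] at hD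
        exact ⟨D, hD.2, by rwa [Function.update_of_ne hD.1]⟩
    · intro D hD E hE s
      by_cases hDC : D = C <;> by_cases hEC : E = C
      · intro _ _; rw [hDC, hEC]
      · subst hDC
        rw [Function.update_self, Function.update_of_ne hEC]
        intro h1 h2
        exact absurd h1 (hrest E hE hEC s h2).2
      · subst hEC
        rw [Function.update_self, Function.update_of_ne hDC]
        intro h1 h2
        exact absurd h2 (hrest D hD hDC s h1).2
      · rw [Function.update_of_ne hDC, Function.update_of_ne hEC]
        exact hb.disjoint D (hmem D hD hDC) E (hmem E hE hEC) s
    · intro D hD E hE hlt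
      have hEC : E ≠ C := by
        rintro rfl
        exact absurd (hmin D hD) (by omega)
      rw [Function.update_of_ne hEC]
      by_cases hDC : D = C
      · subst hDC
        rw [Function.update_self]
        intro u hu v hv
        have := hrest E hE hEC v hv
        exact hAlt u hu v this.1 this.2
      · rw [Function.update_of_ne hDC]
        exact hb.ordered D (hmem D hD hDC) E (hmem E hE hEC) hlt

/-- Sends `L` to the left end, `R` to the right end and everything else to the middle. -/
def endKey {V : Type*} [DecidableEq V] (L R C : Finset V) : ℕ :=
  if C = L then 0 else if C = R then 2 else 1

section Ends

variable {V : Type*} {P : Finset (Finset V)} {J : Finset ℤ} {p a b : ℤ}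
  {L R : Finset V} {blk : Finset V → Finset ℤ}

/-- The only new hole is `p`, which is harmless if it is a multiple of `d` or lies outside the hull
of the block. -/
theorem IsArrangement.gapsDvd {key : Finset V → ℕ} (h : IsArrangement P (J.erase p) key blk) {d : ℤ}
    (hg : GapsDvd d J) {C : Finset V} (hC : C ∈ P)
    (hp : d ∣ p ∨ (∀ u ∈ blk C, u < p) ∨ ∀ u ∈ blk C, p < u) : GapsDvd d (blk C) := by
  intro lo hlo hi hhi z h1 h2 hz
  by_cases hzp : z = p
  · rcases hp with hp | hp | hp
    · rwa [hzp]
    · exact absurd (hp hi hhi) (by omega)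
    · exact absurd (hp lo hlo) (by omega)
  · refine hg lo (Finset.mem_of_mem_erase (h.subset C hC hlo)) hi
      (Finset.mem_of_mem_erase (h.subset C hC hhi)) z h1 h2 fun hzJ => hz ?_
    exact h.convex C hC lo hlo hi hhi z (Finset.mem_erase.2 ⟨hzp, hzJ⟩) h1 h2

variable [DecidableEq V]

theorem IsArrangement.add_card_le (h : IsArrangement P (J.erase p) (endKey L R) blk)
    (ha : ∀ y ∈ J, a ≤ y) (hL : L ∈ P) {C : Finset V} (hC : C ∈ P) (hCL : C ≠ L) {u : ℤ}
    (hu : u ∈ blk C) : a + L.card ≤ u := by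
  have hsub : blk L ⊆ Finset.Ico a u := by
    intro v hv
    refine Finset.mem_Ico.2 ⟨ha v (Finset.mem_of_mem_erase (h.subset L hL hv)), ?_⟩
    refine h.ordered L hL C hC ?_ v hv u hu
    simp only [endKey, if_true, if_neg hCL]
    split_ifs <;> omega
  have hc := Finset.card_le_card hsub
  have := ha u (Finset.mem_of_mem_erase (h.subset C hC hu))
  rw [h.card L hL, Int.card_Ico] at hc
  omega

theorem IsArrangement.le_sub_card (h : IsArrangement P (J.erase p) (endKey L R) blk)
    (hb : ∀ y ∈ J, y ≤ b) (hR : R ∈ P) (hLR : L ≠ R) {C : Finset V} (hC : C ∈ P) (hCR : C ≠ R)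
    {u : ℤ} (hu : u ∈ blk C) : u ≤ b - R.card := by
  have hsub : blk R ⊆ Finset.Ioc u b := by
    intro v hv
    refine Finset.mem_Ioc.2 ⟨?_, hb v (Finset.mem_of_mem_erase (h.subset R hR hv))⟩
    refine h.ordered C hC R hR ?_ u hu v hv
    simp only [endKey, if_true, if_neg hCR, if_neg hLR.symm]
    split_ifs <;> omega
  have hc := Finset.card_le_card hsub
  have := hb u (Finset.mem_of_mem_erase (h.subset C hC hu))
  rw [h.card R hR, Int.card_Ioc] at hc
  omega

/-- The elements of `J` up to `u` lie in the block of `L`, apart possibly from `p`, and their hull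
has at most five holes. -/
theorem IsArrangement.le_add_card (h : IsArrangement P (J.erase p) (endKey L R) blk) {d : ℤ}
    (hd : 8 ≤ d) (hg : GapsDvd d J) (hJ : (J.card : ℤ) ≤ 4 * d) (haJ : a ∈ J)
    (ha : ∀ y ∈ J, a ≤ y) (hL : L ∈ P) {u : ℤ} (hu : u ∈ blk L) : u ≤ a + L.card + 5 := by
  have huJ := Finset.mem_of_mem_erase (h.subset L hL hu)
  set B := J.filter (· ≤ u)
  have hB : B ⊆ insert p (blk L) := by
    intro y hy
    rw [Finset.mem_filter] at hy
    rw [Finset.mem_insert]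
    by_cases hyp : y = p
    · exact Or.inl hyp
    · right
      obtain ⟨C, hC, hyC⟩ := h.cover y (Finset.mem_erase.2 ⟨hyp, hy.1⟩)
      by_cases hCL : C = L
      · rwa [← hCL]
      · have := h.ordered L hL C hC (by
          simp only [endKey, if_true, if_neg hCL]
          split_ifs <;> omega) u hu y hyC
        omega
  have hgB : GapsDvd d B := by
    intro lo hlo hi hhi z h1 h2 hz
    rw [Finset.mem_filter] at hlo hhi hz
    exact hg lo hlo.1 hi hhi.1 z h1 h2 fun hzJ => hz ⟨hzJ, by omega⟩
  have hc : B.card ≤ L.card + 1 := by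
    have := (Finset.card_le_card hB).trans (Finset.card_insert_le _ _)
    rwa [h.card L hL] at this
  have hcJ : B.card ≤ J.card := Finset.card_filter_le _ _
  have := hull_length_le hd hgB (by omega)
    (Finset.mem_filter.2 ⟨haJ, ha u huJ⟩) (Finset.mem_filter.2 ⟨huJ, le_rfl⟩)
  omega

theorem IsArrangement.sub_card_le (h : IsArrangement P (J.erase p) (endKey L R) blk) {d : ℤ}
    (hd : 8 ≤ d) (hg : GapsDvd d J) (hJ : (J.card : ℤ) ≤ 4 * d) (hbJ : b ∈ J)
    (hb : ∀ y ∈ J, y ≤ b) (hR : R ∈ P) (hLR : L ≠ R) {u : ℤ} (hu : u ∈ blk R) :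
    b - R.card - 5 ≤ u := by
  have huJ := Finset.mem_of_mem_erase (h.subset R hR hu)
  set B := J.filter (u ≤ ·)
  have hB : B ⊆ insert p (blk R) := by
    intro y hy
    rw [Finset.mem_filter] at hy
    rw [Finset.mem_insert]
    by_cases hyp : y = p
    · exact Or.inl hyp
    · right
      obtain ⟨C, hC, hyC⟩ := h.cover y (Finset.mem_erase.2 ⟨hyp, hy.1⟩)
      by_cases hCR : C = R
      · rwa [← hCR]
      · have := h.ordered C hC R hR (by
          simp only [endKey, if_true, if_neg hCR, if_neg hLR.symm]
          split_ifs <;> omega) y hyC u hu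
        omega
  have hgB : GapsDvd d B := by
    intro lo hlo hi hhi z h1 h2 hz
    rw [Finset.mem_filter] at hlo hhi hz
    exact hg lo hlo.1 hi hhi.1 z h1 h2 fun hzJ => hz ⟨hzJ, by omega⟩
  have hc : B.card ≤ R.card + 1 := by
    have := (Finset.card_le_card hB).trans (Finset.card_insert_le _ _)
    rwa [h.card R hR] at this
  have hcJ : B.card ≤ J.card := Finset.card_filter_le _ _
  have := hull_length_le hd hgB (by omega)
    (Finset.mem_filter.2 ⟨huJ, le_rfl⟩) (Finset.mem_filter.2 ⟨hbJ, hb u huJ⟩)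
  omega

end Ends

/-! ### Embeddings and gluing. -/

/-- One of the two positions covers the other. -/
def Linked (p q : ℤ) : Prop := Covers p q ∨ Covers q p

/-- `f` embeds the subgraph of `T` induced on `F` into the linked positions in `J`. -/
structure IsEmbedding {V : Type*} (T : SimpleGraph V) (F : Finset V) (J : Finset ℤ) (f : V → ℤ) :
    Prop where
  mapsTo : ∀ u ∈ F, f u ∈ J
  injOn : ∀ u ∈ F, ∀ v ∈ F, f u = f v → u = v
  linked : ∀ u ∈ F, ∀ v ∈ F, T.Adj u v → Linked (f u) (f v)

theorem Linked.symm {p q : ℤ} (h : Linked p q) : Linked q p := Or.symm h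

theorem Linked.neg {p q : ℤ} (h : Linked p q) : Linked (-p) (-q) :=
  h.imp covers_neg_neg covers_neg_neg

/-- The reflected block. -/
def reflect (J : Finset ℤ) : Finset ℤ := J.image fun y => -y

theorem mem_reflect {J : Finset ℤ} {y : ℤ} : y ∈ reflect J ↔ -y ∈ J := by
  simp only [reflect, Finset.mem_image]
  constructor
  · rintro ⟨z, hz, rfl⟩
    simpa using hz
  · exact fun h => ⟨-y, h, by simp⟩

theorem card_reflect (J : Finset ℤ) : (reflect J).card = J.card :=
  Finset.card_image_of_injective _ neg_injective

theorem GapsDvd.reflect {d : ℤ} {J : Finset ℤ} (h : GapsDvd d J) : GapsDvd d (reflect J) := by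
  intro lo hlo hi hhi z h1 h2 hz
  rw [mem_reflect] at hlo hhi hz
  exact (dvd_neg).1 (h (-hi) hhi (-lo) hlo (-z) (by omega) (by omega) hz)

section Glue

variable {V : Type*} {T : SimpleGraph V} {F : Finset V} {J : Finset ℤ}

theorem IsEmbedding.of_reflect {f : V → ℤ} (h : IsEmbedding T F (reflect J) f) :
    IsEmbedding T F J fun u => -f u where
  mapsTo u hu := mem_reflect.1 (h.mapsTo u hu)
  injOn u hu v hv huv := h.injOn u hu v hv (neg_injective huv)
  linked u hu v hv huv := (h.linked u hu v hv huv).neg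

variable [DecidableEq V]

/-- Every edge within `F` is either inside one piece or incident with `x`, so the embeddings of the
pieces can be chosen separately. -/
theorem IsSplit.exists_embedding {x : V} {P : Finset (Finset V)} (hP : IsSplit T F x P) {p : ℤ}
    (hp : p ∈ J) {key : Finset V → ℕ} {blk : Finset V → Finset ℤ}
    (hblk : IsArrangement P (J.erase p) key blk) {g : Finset V → V → ℤ}
    (hg : ∀ C ∈ P, IsEmbedding T C (blk C) (g C))
    (hx : ∀ C ∈ P, ∀ u ∈ C, T.Adj x u → Linked p (g C u)) :
    ∃ f, IsEmbedding T F J f ∧ f x = p ∧ ∀ C ∈ P, ∀ u ∈ C, f u = g C u := by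
  classical
  let f : V → ℤ := fun u => if h : ∃ C ∈ P, u ∈ C then g h.choose u else p
  have hfx : f x = p := by
    refine dif_neg ?_
    rintro ⟨C, hC, hxC⟩
    exact (hP.subset C hC x hxC).2 rfl
  have hfC : ∀ C ∈ P, ∀ u ∈ C, f u = g C u := by
    intro C hC u hu
    have h : ∃ C ∈ P, u ∈ C := ⟨C, hC, hu⟩
    have : f u = g h.choose u := dif_pos h
    rw [this, hP.disjoint _ h.choose_spec.1 C hC u h.choose_spec.2 hu]
  have hfm : ∀ C ∈ P, ∀ u ∈ C, f u ∈ blk C := fun C hC u hu => by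
    rw [hfC C hC u hu]; exact (hg C hC).mapsTo u hu
  have hne : ∀ C ∈ P, ∀ u ∈ C, f u ≠ p := fun C hC u hu =>
    (Finset.mem_erase.1 (hblk.subset C hC (hfm C hC u hu))).1
  refine ⟨f, ⟨?_, ?_, ?_⟩, hfx, hfC⟩
  · intro u hu
    by_cases hux : u = x
    · rw [hux, hfx]; exact hp
    · obtain ⟨C, hC, huC⟩ := hP.cover u hu hux
      exact Finset.mem_of_mem_erase (hblk.subset C hC (hfm C hC u huC))
  · intro u hu v hv huv
    by_cases hux : u = x <;> by_cases hvx : v = x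
    · rw [hux, hvx]
    · obtain ⟨C, hC, hvC⟩ := hP.cover v hv hvx
      rw [hux, hfx] at huv
      exact absurd huv.symm (hne C hC v hvC)
    · obtain ⟨C, hC, huC⟩ := hP.cover u hu hux
      rw [hvx, hfx] at huv
      exact absurd huv (hne C hC u huC)
    · obtain ⟨C, hC, huC⟩ := hP.cover u hu hux
      obtain ⟨D, hD, hvD⟩ := hP.cover v hv hvx
      have hCD := hblk.disjoint C hC D hD (f u) (hfm C hC u huC) (huv ▸ hfm D hD v hvD)
      subst hCD
      rw [hfC C hC u huC, hfC C hC v hvD] at huv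
      exact (hg C hC).injOn u huC v hvD huv
  · intro u hu v hv huv
    by_cases hux : u = x <;> by_cases hvx : v = x
    · rw [hux, hvx] at huv
      exact absurd rfl huv.ne
    · obtain ⟨C, hC, hvC⟩ := hP.cover v hv hvx
      rw [hux, hfx, hfC C hC v hvC]
      exact hx C hC v hvC (hux ▸ huv)
    · obtain ⟨C, hC, huC⟩ := hP.cover u hu hux
      rw [hvx, hfx, hfC C hC u huC]
      exact (hx C hC u huC (hvx ▸ huv.symm)).symm
    · obtain ⟨C, hC, huC⟩ := hP.cover u hu hux
      obtain ⟨D, hD, hvD⟩ := hP.cover v hv hvx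
      have hCD := hP.separated C hC D hD u huC v hvD huv
      subst hCD
      rw [hfC C hC u huC, hfC C hC v hvD]
      exact (hg C hC).linked u huC v hvD huv

end Glue

/-- Since `C` has at most one neighbour of `x`, it is enough to control the position of that vertex.
-/
theorem exists_linked_embedding {V : Type*} {T : SimpleGraph V} {x : V} {C : Finset V} (hne : C.Nonempty)
    (huniq : ∀ u ∈ C, ∀ v ∈ C, T.Adj x u → T.Adj x v → u = v) {B : Finset ℤ} {p w : ℤ}
    (hemb : ∀ v ∈ C, ∃ f, IsEmbedding T C B f ∧ w ≤ f v) (hcov : ∀ y ∈ B, w ≤ y → Covers p y) :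
    ∃ g : V → ℤ, IsEmbedding T C B g ∧ ∀ u ∈ C, T.Adj x u → Linked p (g u) := by
  by_cases h : ∃ v ∈ C, T.Adj x v
  · obtain ⟨v, hv, hxv⟩ := h
    obtain ⟨f, hf, hfv⟩ := hemb v hv
    refine ⟨f, hf, fun u hu hxu => ?_⟩
    rw [huniq u hu v hv hxu hxv]
    exact Or.inl (hcov _ (hf.mapsTo v hv) hfv)
  · obtain ⟨v, hv⟩ := hne
    obtain ⟨f, hf, -⟩ := hemb v hv
    exact ⟨f, hf, fun u hu hxu => (h ⟨u, hu, hxu⟩).elim⟩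

/-! ### Ready blocks. -/

section Embedding

variable {V : Type*} [DecidableEq V] {T : SimpleGraph V}

/-- A sufficient condition for `F` to be embeddable into `J` with any given vertex placed at a
position that is at least `w`. -/
def IsReady (T : SimpleGraph V) (F : Finset V) (J : Finset ℤ) (w : ℤ) : Prop :=
  (J.card ≤ 32 ∧ (∀ u ∈ J, ∀ v ∈ J, v - u ≤ 100) ∧ ∃ y ∈ J, w ≤ y) ∨
  ∃ e : ℕ, 4 ≤ e ∧ 2 * 2 ^ e < J.card ∧ J.card ≤ 4 * 2 ^ e ∧
    ((¬ IsBushy T F e ∧ GapsDvd (2 ^ (e + 1)) J ∧ (∀ y ∈ J, 5 * w + 50 ≤ 5 * y + 8 * 2 ^ e) ∧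
        ∀ k : ℤ, (2 * k + 1) * 2 ^ e ∈ J → w ≤ (2 * k + 1) * 2 ^ e) ∨
      (GapsDvd (2 ^ e) J ∧ (∃ x ∈ F, ∃ P, IsSplit T F x P ∧ (∀ C ∈ P, 5 * C.card ≤ 8 * 2 ^ e)) ∧
        (∃ p ∈ J, (2 : ℤ) ^ e ∣ p ∧ w ≤ p ∧ ∀ y ∈ J, Covers p y) ∧
        ∃ y ∈ J, 5 * w + 8 * 2 ^ e + 50 ≤ 5 * y))

theorem exists_size_class {N : ℕ} (hN : 3 ≤ N) : ∃ l : ℕ, 2 * 2 ^ l < N ∧ N ≤ 4 * 2 ^ l := by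
  have h1 := Nat.pow_log_le_self 2 (x := N - 1) (by omega)
  have h2 := Nat.lt_pow_succ_log_self (b := 2) (by norm_num) (N - 1)
  obtain ⟨l, hl⟩ : ∃ l, Nat.log 2 (N - 1) = l + 1 :=
    Nat.exists_eq_succ_of_ne_zero (Nat.log_pos (by norm_num) (by omega)).ne'
  rw [hl] at h1 h2
  refine ⟨l, ?_, ?_⟩
  · have : 2 ^ (l + 1) = 2 * 2 ^ l := by ring
    omega
  · have : 2 ^ (l + 1).succ = 4 * 2 ^ l := by rw [Nat.succ_eq_add_one]; ring
    omega

theorem eight_le_two_pow {i : ℕ} (hi : 3 ≤ i) : (8 : ℤ) ≤ 2 ^ i := by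
  calc (8 : ℤ) = 2 ^ 3 := by norm_num
    _ ≤ 2 ^ i := pow_le_pow_right₀ (by norm_num) hi

theorem four_le_of_card {N l : ℕ} (h : ¬ N ≤ 32) (hl : N ≤ 4 * 2 ^ l) : 4 ≤ l := by
  by_contra hcon
  have : 2 ^ l ≤ 2 ^ 3 := Nat.pow_le_pow_right (by norm_num) (by omega)
  omega

/-- The criterion by which pieces inherit readiness. -/
theorem isReady_of_gapsDvd {C : Finset V} {B : Finset ℤ} {i : ℕ} {w : ℤ} (hi : 2 ≤ i)
    (hg : GapsDvd (2 ^ (i + 1)) B) (hc : B.card ≤ 4 * 2 ^ i)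
    (hbad : IsBushy T C i → ∀ k : ℤ, ∀ lo ∈ B, ∀ hi ∈ B,
      5 * lo + 8 * 2 ^ i + 500 < 5 * ((2 * k + 1) * 2 ^ (i + 1)) →
      5 * ((2 * k + 1) * 2 ^ (i + 1)) + 8 * 2 ^ i + 500 < 5 * hi →
      (2 * k + 1) * 2 ^ (i + 1) ∈ B)
    (hw1 : ∃ y ∈ B, 5 * w + 8 * 2 ^ i + 50 ≤ 5 * y)
    (hw2 : ∀ l : ℕ, 2 * 2 ^ l < B.card → B.card ≤ 4 * 2 ^ l →
      (∀ y ∈ B, 5 * w + 50 ≤ 5 * y + 8 * 2 ^ l) ∧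
        ∀ k : ℤ, (2 * k + 1) * 2 ^ l ∈ B → w ≤ (2 * k + 1) * 2 ^ l) :
    IsReady T C B w := by
  obtain ⟨y₀, hy₀, hwy₀⟩ := hw1
  by_cases h32 : B.card ≤ 32
  · left
    refine ⟨h32, fun u hu v hv => hull_length_le_of_card_le (eight_le_two_pow (by omega)) hg h32
      hu hv, y₀, hy₀, ?_⟩
    have : (0 : ℤ) < 2 ^ i := by positivity
    linarith
  right
  obtain ⟨l, hl1, hl2⟩ := exists_size_class (N := B.card) (by omega)
  have hl4 : 4 ≤ l := four_le_of_card h32 hl2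
  have hli : l ≤ i := by
    by_contra hcon
    have : 2 ^ (i + 1) ≤ 2 ^ l := Nat.pow_le_pow_right (by norm_num) (by omega)
    rw [pow_succ] at this
    omega
  have hgl : GapsDvd (2 ^ (l + 1)) B := hg.mono (pow_dvd_pow 2 (by omega))
  obtain ⟨hw2, hw3⟩ := hw2 l hl1 hl2
  refine ⟨l, hl4, hl1, hl2, ?_⟩
  by_cases hb : IsBushy T C l
  swap
  · exact Or.inl ⟨hb, hgl, hw2, hw3⟩
  right
  have hpow : (2 : ℤ) ^ l ≤ 2 ^ i := pow_le_pow_right₀ (by norm_num) hli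
  refine ⟨hgl.mono (pow_dvd_pow 2 (by omega)), hb, ?_, y₀, hy₀, by linarith⟩
  rcases exists_covers_or_bad (by omega) hl1 hl2 hgl with ⟨k, hk, hcov⟩ |
    ⟨k, lo, hlo, hi', hhi, h1, h2⟩
  · exact ⟨_, hk, Dvd.intro_left _ rfl, hw3 k hk, hcov⟩
  -- In the bad case the central multiple of 2^(l+1) is itself free: for l = i by `hbad`, for l < i
  -- because holes are multiples of 2^(l+2). Its reach (26/5)·2^l exceeds the length of the block.
  · have hz : (2 * k + 1) * 2 ^ (l + 1) ∈ B := by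
      rcases hli.eq_or_lt with rfl | hlt
      · exact hbad hb k lo hlo hi' hhi h1 h2
      · by_contra hn
        have hpos : (0 : ℤ) < 2 ^ l := by positivity
        have := hg lo hlo hi' hhi _ (by linarith) (by linarith) hn
        refine not_dvd_odd_mul (by positivity) ((?_ : (2 : ℤ) * 2 ^ (l + 1) ∣ 2 ^ (i + 1)).trans this)
        rw [← pow_succ']
        exact pow_dvd_pow 2 (by omega)
    refine ⟨_, hz, (pow_dvd_pow 2 (by omega)).trans (Dvd.intro_left _ rfl), ?_, ?_⟩
    · linarith [hw2 lo hlo]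
    · intro y hy
      have h8 := eight_le_two_pow (show 3 ≤ l by omega)
      have hp : (2 : ℤ) ^ (l + 1) = 2 * 2 ^ l := by ring
      have hcz : (B.card : ℤ) ≤ 4 * 2 ^ l := by exact_mod_cast hl2
      have hA := hull_length_le (d := 2 ^ (l + 1)) (by linarith) hgl (by linarith) hz hy
      have hB := hull_length_le (d := 2 ^ (l + 1)) (by linarith) hgl (by linarith) hy hz
      exact covers_of_dvd (j := l + 1) (Dvd.intro_left _ rfl) (by linarith) (by linarith)

/-- With `w` far to the left, all conditions on the prescribed vertex are vacuous. -/
theorem exists_isReady {C : Finset V} {B : Finset ℤ} {i : ℕ} (hi : 2 ≤ i) (hB : B.Nonempty)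
    (hg : GapsDvd (2 ^ (i + 1)) B) (hc : B.card ≤ 4 * 2 ^ i)
    (hbad : IsBushy T C i → ∀ k : ℤ, ∀ lo ∈ B, ∀ hi ∈ B,
      5 * lo + 8 * 2 ^ i + 500 < 5 * ((2 * k + 1) * 2 ^ (i + 1)) →
      5 * ((2 * k + 1) * 2 ^ (i + 1)) + 8 * 2 ^ i + 500 < 5 * hi →
      (2 * k + 1) * 2 ^ (i + 1) ∈ B) :
    ∃ w, IsReady T C B w := by
  obtain ⟨a, ha, hmin⟩ := Finset.exists_min_image B id hB
  simp only [id] at hmin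
  have hpos : (0 : ℤ) < 2 ^ i := by positivity
  refine ⟨a - 2 * 2 ^ i - 10, isReady_of_gapsDvd hi hg hc hbad ⟨a, ha, by linarith⟩
    fun l _ _ => ⟨fun y hy => ?_, fun k hk => ?_⟩⟩
  · have : (0 : ℤ) < 2 ^ l := by positivity
    linarith [hmin y hy]
  · linarith [hmin _ hk]

/-- A bushy piece tolerates holes that are only multiples of 2^i, provided that a free multiple of
2^(i+1) is at hand: it covers the whole block. -/
theorem isReady_of_isBushy {C : Finset V} {B : Finset ℤ} {i : ℕ} {w p : ℤ} (hi : 3 ≤ i)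
    (hg : GapsDvd (2 ^ i) B) (hc : 2 * 2 ^ i < B.card) (hc' : B.card ≤ 4 * 2 ^ i)
    (hb : IsBushy T C i) (hp : p ∈ B) (hpi : (2 : ℤ) ^ (i + 1) ∣ p) (hwp : w ≤ p)
    (hw : ∃ y ∈ B, 5 * w + 8 * 2 ^ i + 50 ≤ 5 * y) : IsReady T C B w := by
  have h8 := eight_le_two_pow hi
  by_cases h32 : B.card ≤ 32
  · exact Or.inl ⟨h32, fun u hu v hv => hull_length_le_of_card_le h8 hg h32
      hu hv, p, hp, hwp⟩
  · have hcz : (B.card : ℤ) ≤ 4 * 2 ^ i := by exact_mod_cast hc'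
    refine Or.inr ⟨i, four_le_of_card h32 hc', hc, hc', Or.inr ⟨hg, hb,
      ⟨p, hp, (pow_dvd_pow 2 (by omega)).trans hpi, hwp, fun y hy => ?_⟩, hw⟩⟩
    have hA := hull_length_le h8 hg hcz hp hy
    have hB := hull_length_le h8 hg hcz hy hp
    have hpw : (2 : ℤ) ^ (i + 1) = 2 * 2 ^ i := by ring
    exact covers_of_dvd hpi (by linarith) (by linarith)

/-! ### Wide blocks and the conditions on a separator. -/

/-- A block `J` with extreme elements `a`, `b` and `2 ^ (i + 2) < |J| ≤ 2 ^ (i + 3)`, together with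
a balanced split of `F` for which the heavy pieces are among `L` and `R`, and embeddings of all
pieces into ready blocks. -/
structure WideBlock (T : SimpleGraph V) (F : Finset V) (x : V) (P : Finset (Finset V))
    (L R : Finset V) (J : Finset ℤ) (i : ℕ) (a b : ℤ) : Prop where
  split : IsSplit T F x P
  mem : x ∈ F
  card_eq : J.card = F.card
  gaps : GapsDvd (2 ^ (i + 2)) J
  three_le : 3 ≤ i
  lt_card : 4 * 2 ^ i < (J.card : ℤ)
  card_le : (J.card : ℤ) ≤ 8 * 2 ^ i
  left_mem : a ∈ J
  left_le : ∀ y ∈ J, a ≤ y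
  right_mem : b ∈ J
  le_right : ∀ y ∈ J, y ≤ b
  half : ∀ C ∈ P, 2 * (C.card : ℤ) ≤ J.card
  half_left : 2 * (L.card : ℤ) ≤ J.card
  half_right : 2 * (R.card : ℤ) ≤ J.card
  heavy : ∀ C ∈ P, 16 * 2 ^ i < 5 * (C.card : ℤ) → C = L ∨ C = R
  heavy_left : L ∈ P → 16 * 2 ^ i < 5 * (L.card : ℤ)
  heavy_right : R ∈ P → 16 * 2 ^ i < 5 * (R.card : ℤ)
  ne : L ≠ R
  embed : ∀ C ∈ P, ∀ B w v, B.card = C.card → v ∈ C → IsReady T C B w →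
    ∃ f, IsEmbedding T C B f ∧ w ≤ f v

/-- With `x` placed at `p`, the pieces can be embedded into consecutive blocks. -/
def HasPlacement (T : SimpleGraph V) (x : V) (P : Finset (Finset V)) (key : Finset V → ℕ)
    (J : Finset ℤ) (p : ℤ) : Prop :=
  ∃ blk, IsArrangement P (J.erase p) key blk ∧ ∃ g : Finset V → V → ℤ,
    ∀ C ∈ P, IsEmbedding T C (blk C) (g C) ∧ ∀ u ∈ C, T.Adj x u → Linked p (g C u)

namespace WideBlock

variable {F : Finset V} {x : V} {P : Finset (Finset V)} {L R : Finset V} {J : Finset ℤ} {i : ℕ}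
  {a b p : ℤ} {blk : Finset V → Finset ℤ}

theorem exists_arrangement (h : WideBlock T F x P L R J i a b) (hp : p ∈ J) :
    ∃ blk, IsArrangement P (J.erase p) (endKey L R) blk :=
  _root_.exists_arrangement _ _ _ (by
    rw [h.split.sum_card, Finset.card_erase_of_mem hp, Finset.card_erase_of_mem h.mem, h.card_eq])

theorem length (h : WideBlock T F x P L R J i a b) :
    b - a + 1 ≤ J.card + 5 ∧ (J.card : ℤ) ≤ b - a + 1 ∧ (8 : ℤ) ≤ 2 ^ i := by
  have h8 := eight_le_two_pow h.three_le
  have hp : (2 : ℤ) ^ (i + 2) = 4 * 2 ^ i := by ring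
  refine ⟨hull_length_le (d := 2 ^ (i + 2)) (by linarith) h.gaps (by linarith [h.card_le])
    h.left_mem h.right_mem, card_le_of_mem_hull (fun y hy => ⟨h.left_le y hy, h.le_right y hy⟩) ?_,
    h8⟩
  linarith [h.left_le b h.right_mem]

theorem odd_mul_mem (h : WideBlock T F x P L R J i a b) {d : ℤ} (hd : d ∣ 2 ^ (i + 1)) (hd0 : 0 < d)
    {k : ℤ} (h1 : a ≤ (2 * k + 1) * d) (h2 : (2 * k + 1) * d ≤ b) : (2 * k + 1) * d ∈ J := by
  by_contra hn
  have := h.gaps a h.left_mem b h.right_mem _ h1 h2 hn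
  refine not_dvd_odd_mul hd0 (dvd_trans ?_ this)
  rw [show i + 2 = (i + 1) + 1 from rfl, pow_succ']
  exact mul_dvd_mul_left 2 hd

theorem left_bounds (h : WideBlock T F x P L R J i a b)
    (hb : IsArrangement P (J.erase p) (endKey L R) blk) (hL : L ∈ P) :
    (∀ C ∈ P, C ≠ L → ∀ u ∈ blk C, a + L.card ≤ u) ∧ ∀ u ∈ blk L, u ≤ a + L.card + 5 := by
  refine ⟨fun C hC hCL u hu => hb.add_card_le h.left_le hL hC hCL hu, fun u hu => ?_⟩
  have hp : (2 : ℤ) ^ (i + 2) = 4 * 2 ^ i := by ring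
  exact hb.le_add_card (d := 2 ^ (i + 2)) (by linarith [h.length.2.2]) h.gaps
    (by linarith [h.card_le, h.length.2.2]) h.left_mem h.left_le hL hu

theorem right_bounds (h : WideBlock T F x P L R J i a b)
    (hb : IsArrangement P (J.erase p) (endKey L R) blk) (hR : R ∈ P) :
    (∀ C ∈ P, C ≠ R → ∀ u ∈ blk C, u ≤ b - R.card) ∧ ∀ u ∈ blk R, b - R.card - 5 ≤ u := by
  refine ⟨fun C hC hCR u hu => hb.le_sub_card h.le_right hR h.ne hC hCR hu, fun u hu => ?_⟩
  have hp : (2 : ℤ) ^ (i + 2) = 4 * 2 ^ i := by ring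
  exact hb.sub_card_le (d := 2 ^ (i + 2)) (by linarith [h.length.2.2]) h.gaps
    (by linarith [h.card_le, h.length.2.2]) h.right_mem h.le_right hR h.ne hu

theorem mem_hull (h : WideBlock T F x P L R J i a b)
    (hb : IsArrangement P (J.erase p) (endKey L R) blk) {C : Finset V} (hC : C ∈ P) {u : ℤ}
    (hu : u ∈ blk C) : u ∈ J ∧ a ≤ u ∧ u ≤ b := by
  have := Finset.mem_of_mem_erase (hb.subset C hC hu)
  exact ⟨this, h.left_le u this, h.le_right u this⟩

theorem card_blk_le (h : WideBlock T F x P L R J i a b)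
    (hb : IsArrangement P (J.erase p) (endKey L R) blk) {C : Finset V} (hC : C ∈ P) :
    (blk C).card ≤ 4 * 2 ^ i := by
  have h1 := h.half C hC
  have h2 := h.card_le
  have h3 := hb.card C hC
  have : ((blk C).card : ℤ) ≤ ((4 * 2 ^ i : ℕ) : ℤ) := by push_cast; rw [h3]; linarith
  exact_mod_cast this

/-- A piece whose block extends far to both sides of a position is heavy. -/
theorem eq_or_eq_of_extends (h : WideBlock T F x P L R J i a b)
    (hb : IsArrangement P (J.erase p) (endKey L R) blk) {C : Finset V} (hC : C ∈ P)
    (hg : GapsDvd (2 ^ (i + 1)) (blk C)) {lo hi z : ℤ} (hlo : lo ∈ blk C) (hhi : hi ∈ blk C)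
    (h1 : 5 * lo + 8 * 2 ^ i + 500 < 5 * z) (h2 : 5 * z + 8 * 2 ^ i + 500 < 5 * hi) :
    C = L ∨ C = R := by
  have h8 := h.length.2.2
  have hp : (2 : ℤ) ^ (i + 1) = 2 * 2 ^ i := by ring
  have hc := h.half C hC
  have hcard : ((blk C).card : ℤ) = C.card := by exact_mod_cast hb.card C hC
  have := hull_length_le (d := 2 ^ (i + 1)) (by linarith) hg
    (by linarith [h.card_le]) hlo hhi
  exact h.heavy C hC (by linarith)

/-- `L` is not a bushy piece which extends far to both sides of `p`. -/
def LeftFine (T : SimpleGraph V) (L : Finset V) (i : ℕ) (a p : ℤ) : Prop :=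
  IsBushy T L i → 5 * a + 8 * 2 ^ i + 500 < 5 * p →
    5 * p + 8 * 2 ^ i + 500 < 5 * (a + L.card + 5) → False

/-- `R` is not a bushy piece which extends far to both sides of `p`. -/
def RightFine (T : SimpleGraph V) (R : Finset V) (i : ℕ) (b p : ℤ) : Prop :=
  IsBushy T R i → 5 * (b - R.card - 5) + 8 * 2 ^ i + 500 < 5 * p →
    5 * p + 8 * 2 ^ i + 500 < 5 * b → False

/-- Odd multiples of 2^(i+1) within the hull are in `J`, so only `p` can be missing. A piece
extending far to both sides of `p` is heavy, hence `L` or `R`, and these are excluded by `hL` and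
`hR`. -/
theorem bad_mem (h : WideBlock T F x P L R J i a b)
    (hb : IsArrangement P (J.erase p) (endKey L R) blk) {C : Finset V} (hC : C ∈ P)
    (hg : GapsDvd (2 ^ (i + 1)) (blk C)) (hL : LeftFine T L i a p) (hR : RightFine T R i b p)
    (hbushy : IsBushy T C i) {k lo hi : ℤ} (hlo : lo ∈ blk C) (hhi : hi ∈ blk C)
    (h1 : 5 * lo + 8 * 2 ^ i + 500 < 5 * ((2 * k + 1) * 2 ^ (i + 1)))
    (h2 : 5 * ((2 * k + 1) * 2 ^ (i + 1)) + 8 * 2 ^ i + 500 < 5 * hi) :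
    (2 * k + 1) * 2 ^ (i + 1) ∈ blk C := by
  have h8 := h.length.2.2
  have hlo' := h.mem_hull hb hC hlo
  have hhi' := h.mem_hull hb hC hhi
  have hzJ := h.odd_mul_mem (k := k) dvd_rfl (by positivity) (by linarith) (by linarith)
  refine hb.convex C hC lo hlo hi hhi _ (Finset.mem_erase.2 ⟨?_, hzJ⟩) (by linarith) (by linarith)
  intro hz
  rw [hz] at h1 h2
  rcases h.eq_or_eq_of_extends hb hC hg hlo hhi h1 h2 with rfl | rfl
  · have := (h.left_bounds hb hC).2 hi hhi
    exact hL hbushy (by linarith) (by linarith)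
  · have := (h.right_bounds hb hC).2 lo hlo
    exact hR hbushy (by linarith) (by linarith)

/-- A piece can be embedded into its block if the window of `p` covers the block. -/
theorem exists_embedding_of_covers (h : WideBlock T F x P L R J i a b)
    (hb : IsArrangement P (J.erase p) (endKey L R) blk) {C : Finset V} (hC : C ∈ P)
    (hg : GapsDvd (2 ^ (i + 1)) (blk C))
    (hbad : IsBushy T C i → ∀ k : ℤ, ∀ lo ∈ blk C, ∀ hi ∈ blk C,
      5 * lo + 8 * 2 ^ i + 500 < 5 * ((2 * k + 1) * 2 ^ (i + 1)) →
      5 * ((2 * k + 1) * 2 ^ (i + 1)) + 8 * 2 ^ i + 500 < 5 * hi →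
      (2 * k + 1) * 2 ^ (i + 1) ∈ blk C)
    (hcov : ∀ y ∈ blk C, Covers p y) :
    ∃ g, IsEmbedding T C (blk C) g ∧ ∀ u ∈ C, T.Adj x u → Linked p (g u) := by
  have hne : (blk C).Nonempty := by
    rw [← Finset.card_pos, hb.card C hC, Finset.card_pos]
    exact h.split.nonempty C hC
  obtain ⟨w, hw⟩ := exists_isReady (T := T) (by linarith [h.three_le]) hne hg
    (h.card_blk_le hb hC) hbad
  exact exists_linked_embedding (h.split.nonempty C hC) (h.split.unique C hC)
    (fun v hv => h.embed C hC _ w v (hb.card C hC) hv hw) fun y hy _ => hcov y hy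

theorem exists_embedding_of_isReady (h : WideBlock T F x P L R J i a b)
    (hb : IsArrangement P (J.erase p) (endKey L R) blk) {C : Finset V} (hC : C ∈ P) {w : ℤ}
    (hw : IsReady T C (blk C) w) (hcov : ∀ y ∈ blk C, w ≤ y → Covers p y) :
    ∃ g, IsEmbedding T C (blk C) g ∧ ∀ u ∈ C, T.Adj x u → Linked p (g u) :=
  exists_linked_embedding (h.split.nonempty C hC) (h.split.unique C hC)
    (fun v hv => h.embed C hC _ w v (hb.card C hC) hv hw) hcov

/-- Readiness controls the prescribed vertex only from below; windows are invariant under negation,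
so the reflected block gives control from above. -/
theorem exists_embedding_of_isReady_reflect (h : WideBlock T F x P L R J i a b)
    (hb : IsArrangement P (J.erase p) (endKey L R) blk) {C : Finset V} (hC : C ∈ P) {w : ℤ}
    (hw : IsReady T C (reflect (blk C)) (-w)) (hcov : ∀ y ∈ blk C, y ≤ w → Covers p y) :
    ∃ g, IsEmbedding T C (blk C) g ∧ ∀ u ∈ C, T.Adj x u → Linked p (g u) := by
  obtain ⟨g, hg, hgx⟩ := exists_linked_embedding (T := T) (p := -p) (w := -w)
    (h.split.nonempty C hC) (h.split.unique C hC)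
    (fun v hv => h.embed C hC _ _ v (by rw [card_reflect, hb.card C hC]) hv hw)
    (fun y hy hwy => by
      have := covers_neg_neg (hcov (-y) (mem_reflect.1 hy) (by linarith))
      rwa [neg_neg] at this)
  refine ⟨_, hg.of_reflect, fun u hu hxu => ?_⟩
  have := (hgx u hu hxu).neg
  rwa [neg_neg] at this

theorem hasPlacement_of_forall (hb : IsArrangement P (J.erase p) (endKey L R) blk)
    (h : ∀ C ∈ P, ∃ g, IsEmbedding T C (blk C) g ∧ ∀ u ∈ C, T.Adj x u → Linked p (g u)) :
    HasPlacement T x P (endKey L R) J p := by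
  choose! g hg using h
  exact ⟨blk, hb, g, hg⟩

theorem hasPlacement_of_covers (h : WideBlock T F x P L R J i a b) (hp : p ∈ J)
    (hpi : (2 : ℤ) ^ (i + 1) ∣ p) (hL : LeftFine T L i a p) (hR : RightFine T R i b p)
    (hcov : ∀ y ∈ J, Covers p y) : HasPlacement T x P (endKey L R) J p := by
  obtain ⟨blk, hb⟩ := h.exists_arrangement hp
  refine hasPlacement_of_forall hb fun C hC => ?_
  have hg := hb.gapsDvd (h.gaps.mono (pow_dvd_pow 2 (by omega))) hC (Or.inl hpi)
  exact h.exists_embedding_of_covers hb hC hg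
    (fun hbu k lo hlo hi hhi h1 h2 => h.bad_mem hb hC hg hL hR hbu hlo hhi h1 h2)
    fun y hy => hcov y (h.mem_hull hb hC hy).1

end WideBlock

end Embedding

/-! ### Placing the separator of a wide block. -/

theorem exists_ge_add_card {B : Finset ℤ} (hB : B.Nonempty) {a : ℤ} (h : ∀ y ∈ B, a ≤ y) :
    ∃ y ∈ B, a + B.card - 1 ≤ y := by
  by_contra! hcon
  have h1 := card_le_of_mem_hull (J := B) (a := a) (b := a + B.card - 2)
    (fun y hy => ⟨h y hy, by linarith [hcon y hy]⟩) (by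
      have : 0 < B.card := Finset.card_pos.2 hB
      omega)
  omega

theorem exists_le_sub_card {B : Finset ℤ} (hB : B.Nonempty) {b : ℤ} (h : ∀ y ∈ B, y ≤ b) :
    ∃ y ∈ B, y ≤ b - B.card + 1 := by
  by_contra! hcon
  have h1 := card_le_of_mem_hull (J := B) (a := b - B.card + 2) (b := b)
    (fun y hy => ⟨by linarith [hcon y hy], h y hy⟩) (by
      have : 0 < B.card := Finset.card_pos.2 hB
      omega)
  omega

/-- A heavy piece has more than (16/5)·2^i > 2·2^i vertices, which pins down its size class. -/
theorem size_class_eq {N i l : ℕ} (h1 : 16 * 2 ^ i < 5 * N) (h2 : N ≤ 4 * 2 ^ i)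
    (h3 : 2 * 2 ^ l < N) (h4 : N ≤ 4 * 2 ^ l) : l = i := by
  rcases lt_trichotomy l i with h | h | h
  · have : 2 ^ (l + 1) ≤ 2 ^ i := Nat.pow_le_pow_right (by norm_num) h
    rw [pow_succ] at this
    omega
  · exact h
  · have : 2 ^ (i + 1) ≤ 2 ^ l := Nat.pow_le_pow_right (by norm_num) h
    rw [pow_succ] at this
    omega

section Embedding

variable {V : Type*} [DecidableEq V] {T : SimpleGraph V}

namespace WideBlock

variable {F : Finset V} {x : V} {P : Finset (Finset V)} {L R : Finset V} {J : Finset ℤ} {i : ℕ}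
  {a b p : ℤ} {blk : Finset V → Finset ℤ}

theorem blk_nonempty (h : WideBlock T F x P L R J i a b)
    (hb : IsArrangement P (J.erase p) (endKey L R) blk) {C : Finset V} (hC : C ∈ P) :
    (blk C).Nonempty := by
  rw [← Finset.card_pos, hb.card C hC, Finset.card_pos]
  exact h.split.nonempty C hC

/-- The separator is placed so far to the right that only the neighbour in `L` has to be placed
with care. -/
theorem hasPlacement_of_left (h : WideBlock T F x P L R J i a b) (hLP : L ∈ P) {m : ℤ}
    (hp : (2 * m + 1) * 2 ^ (i + 1) + 4 * 2 ^ i ∈ J)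
    (ha : 5 * ((2 * m + 1) * 2 ^ (i + 1) - a) ≤ 14 * 2 ^ i)
    (hb' : b - ((2 * m + 1) * 2 ^ (i + 1) + 4 * 2 ^ i) ≤ 4 * 2 ^ i + 5)
    (hR : RightFine T R i b ((2 * m + 1) * 2 ^ (i + 1) + 4 * 2 ^ i)) :
    HasPlacement T x P (endKey L R) J ((2 * m + 1) * 2 ^ (i + 1) + 4 * 2 ^ i) := by
  obtain ⟨hlen, hlen', h8⟩ := h.length
  have hpi : (2 : ℤ) ^ (i + 1) ∣ (2 * m + 1) * 2 ^ (i + 1) + 4 * 2 ^ i :=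
    ⟨2 * m + 3, by ring⟩
  have hpow : (2 : ℤ) ^ (i + 1) = 2 * 2 ^ i := by ring
  have hq : (2 * m + 1) * (2 : ℤ) ^ (i + 1) = (4 * m + 2) * 2 ^ i := by ring
  have hhl := h.half_left
  have hheavy := h.heavy_left hLP
  have hJ := h.card_le
  rw [hq] at hp ha hb' hR hpi ⊢
  set q : ℤ := (4 * m + 2) * 2 ^ i with hqdef
  have hL : LeftFine T L i a (q + 4 * 2 ^ i) := fun _ h1 h2 => by linarith
  obtain ⟨blk, hb⟩ := h.exists_arrangement hp
  obtain ⟨hbl, hbl'⟩ := h.left_bounds hb hLP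
  refine hasPlacement_of_forall hb fun C hC => ?_
  have hg := hb.gapsDvd (h.gaps.mono (pow_dvd_pow 2 (by omega))) hC (Or.inl hpi)
  by_cases hCL : C = L
  · subst hCL
    obtain ⟨y₀, hy₀, hy₀'⟩ := exists_ge_add_card (h.blk_nonempty hb hC)
      (fun y hy => (h.mem_hull hb hC hy).2.1)
    rw [hb.card C hC] at hy₀'
    -- The bound `w` is the left end of the window of the separator, about q - (6/5)·2^i. As q - a ≤
    -- (14/5)·2^i, it exceeds `a` by less than (8/5)·2^i, the slack allowed by `IsReady`.
    have hw : 5 * (q + 4 * 2 ^ i - (26 * 2 ^ i + 500) / 5) ≤ 5 * q - 6 * 2 ^ i - 496 := by omega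
    have hw' : 5 * ((26 * 2 ^ i + 500) / 5) ≤ (26 * 2 ^ i + 500 : ℤ) := by omega
    set w : ℤ := q + 4 * 2 ^ i - (26 * 2 ^ i + 500) / 5 with hwdef
    refine h.exists_embedding_of_isReady hb hC (w := w) (isReady_of_gapsDvd
      (by linarith [h.three_le]) hg (h.card_blk_le hb hC)
      (fun hbu k lo hlo hi hhi h1 h2 => h.bad_mem hb hC hg hL hR hbu hlo hhi h1 h2)
      ⟨y₀, hy₀, by linarith⟩ ?_) ?_
    · intro l hl1 hl2
      have hl : l = i := by
        refine size_class_eq ?_ (h.card_blk_le hb hC) hl1 hl2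
        rw [hb.card C hC]
        exact_mod_cast hheavy
      subst hl
      refine ⟨fun y hy => ?_, fun k hk => ?_⟩
      · linarith [(h.mem_hull hb hC hy).2.1]
      · have hk' := (h.mem_hull hb hC hk).2.1
        -- The odd multiple q - 2^i lies to the right of `w`, and q - 3·2^i is already to the left
        -- of `a`.
        rcases le_or_gt (2 * k + 1) (4 * m - 1) with hkm | hkm
        · have := mul_le_mul_of_nonneg_right hkm (by linarith : (0 : ℤ) ≤ 2 ^ l)
          linarith
        · have := mul_le_mul_of_nonneg_right (show 4 * m + 1 ≤ 2 * k + 1 by omega)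
            (by linarith : (0 : ℤ) ≤ 2 ^ l)
          linarith
    · intro y hy hwy
      have := h.mem_hull hb hC hy
      exact covers_of_dvd hpi (by linarith) (by linarith)
  · refine h.exists_embedding_of_covers hb hC hg
      (fun hbu k lo hlo hi hhi h1 h2 => h.bad_mem hb hC hg hL hR hbu hlo hhi h1 h2)
      fun y hy => ?_
    have h1 := h.mem_hull hb hC hy
    have h2 := hbl C hC hCL y hy
    exact covers_of_dvd hpi (by linarith) (by linarith)

/-- The mirror image of `hasPlacement_of_left`. -/
theorem hasPlacement_of_right (h : WideBlock T F x P L R J i a b) (hRP : R ∈ P) {m : ℤ}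
    (hp : (2 * m + 1) * 2 ^ (i + 1) - 4 * 2 ^ i ∈ J)
    (hb' : 5 * (b - (2 * m + 1) * 2 ^ (i + 1)) ≤ 14 * 2 ^ i)
    (ha : (2 * m + 1) * 2 ^ (i + 1) - 4 * 2 ^ i - a ≤ 4 * 2 ^ i + 5)
    (hL : LeftFine T L i a ((2 * m + 1) * 2 ^ (i + 1) - 4 * 2 ^ i)) :
    HasPlacement T x P (endKey L R) J ((2 * m + 1) * 2 ^ (i + 1) - 4 * 2 ^ i) := by
  obtain ⟨hlen, hlen', h8⟩ := h.length
  have hpi : (2 : ℤ) ^ (i + 1) ∣ (2 * m + 1) * 2 ^ (i + 1) - 4 * 2 ^ i :=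
    ⟨2 * m - 1, by ring⟩
  have hpow : (2 : ℤ) ^ (i + 1) = 2 * 2 ^ i := by ring
  have hq : (2 * m + 1) * (2 : ℤ) ^ (i + 1) = (4 * m + 2) * 2 ^ i := by ring
  have hhl := h.half_right
  have hheavy := h.heavy_right hRP
  have hJ := h.card_le
  rw [hq] at hp ha hb' hL hpi ⊢
  set q : ℤ := (4 * m + 2) * 2 ^ i with hqdef
  have hR : RightFine T R i b (q - 4 * 2 ^ i) := fun _ h1 h2 => by linarith
  obtain ⟨blk, hb⟩ := h.exists_arrangement hp
  obtain ⟨hbl, hbl'⟩ := h.right_bounds hb hRP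
  refine hasPlacement_of_forall hb fun C hC => ?_
  have hg := hb.gapsDvd (h.gaps.mono (pow_dvd_pow 2 (by omega))) hC (Or.inl hpi)
  by_cases hCR : C = R
  · subst hCR
    obtain ⟨y₀, hy₀, hy₀'⟩ := exists_le_sub_card (h.blk_nonempty hb hC)
      (fun y hy => (h.mem_hull hb hC hy).2.2)
    rw [hb.card C hC] at hy₀'
    have hw : 5 * q + 6 * 2 ^ i + 496 ≤ 5 * (q - 4 * 2 ^ i + (26 * 2 ^ i + 500) / 5) := by omega
    have hw' : 5 * ((26 * 2 ^ i + 500) / 5) ≤ (26 * 2 ^ i + 500 : ℤ) := by omega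
    set w : ℤ := q - 4 * 2 ^ i + (26 * 2 ^ i + 500) / 5 with hwdef
    refine h.exists_embedding_of_isReady_reflect hb hC (w := w) (isReady_of_gapsDvd
      (by linarith [h.three_le]) hg.reflect ((card_reflect _).trans_le (h.card_blk_le hb hC))
      (fun hbu k lo hlo hi hhi h1 h2 => ?_)
      ⟨-y₀, mem_reflect.2 (by rwa [neg_neg]), by linarith⟩ ?_) ?_
    · rw [mem_reflect] at hlo hhi ⊢
      have := h.bad_mem hb hC hg hL hR hbu (k := -k - 1) hhi hlo (by linarith) (by linarith)
      convert this using 1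
      ring
    · intro l hl1 hl2
      rw [card_reflect] at hl1 hl2
      have hl : l = i := by
        refine size_class_eq ?_ (h.card_blk_le hb hC) hl1 hl2
        rw [hb.card C hC]
        exact_mod_cast hheavy
      subst hl
      refine ⟨fun y hy => ?_, fun k hk => ?_⟩
      · linarith [(h.mem_hull hb hC (mem_reflect.1 hy)).2.2]
      · have hk' := (h.mem_hull hb hC (mem_reflect.1 hk)).2.2
        rcases le_or_gt (2 * k + 1) (-4 * m - 5) with hkm | hkm
        · have := mul_le_mul_of_nonneg_right hkm (by linarith : (0 : ℤ) ≤ 2 ^ l)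
          linarith
        · have := mul_le_mul_of_nonneg_right (show -4 * m - 3 ≤ 2 * k + 1 by omega)
            (by linarith : (0 : ℤ) ≤ 2 ^ l)
          linarith
    · intro y hy hwy
      have := h.mem_hull hb hC hy
      exact covers_of_dvd hpi (by linarith) (by linarith)
  · refine h.exists_embedding_of_covers hb hC hg
      (fun hbu k lo hlo hi hhi h1 h2 => h.bad_mem hb hC hg hL hR hbu hlo hhi h1 h2)
      fun y hy => ?_
    have h1 := h.mem_hull hb hC hy
    have h2 := hbl C hC hCR y hy
    exact covers_of_dvd hpi (by linarith) (by linarith)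

/-- If `L` and `R` are both bushy and need the two positions suitable for the separator, then the
separator is placed between them, at a position of half the width. -/
theorem hasPlacement_of_both (h : WideBlock T F x P L R J i a b) (hLP : L ∈ P) (hRP : R ∈ P)
    {m : ℤ} (hLb : IsBushy T L i) (hRb : IsBushy T R i)
    (h1 : 5 * a + 8 * 2 ^ i + 500 < 5 * ((2 * m + 1) * 2 ^ (i + 1)))
    (h2 : 5 * ((2 * m + 1) * 2 ^ (i + 1)) + 8 * 2 ^ i + 500 < 5 * (a + L.card + 5))
    (h3 : 5 * (b - R.card - 5) + 8 * 2 ^ i + 500 < 5 * ((2 * m + 1) * 2 ^ (i + 1) + 4 * 2 ^ i))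
    (h4 : 5 * ((2 * m + 1) * 2 ^ (i + 1) + 4 * 2 ^ i) + 8 * 2 ^ i + 500 < 5 * b) :
    (2 * m + 1) * 2 ^ (i + 1) + 2 ^ i ∈ J ∧
      HasPlacement T x P (endKey L R) J ((2 * m + 1) * 2 ^ (i + 1) + 2 ^ i) := by
  obtain ⟨hlen, hlen', h8⟩ := h.length
  have hpow : (2 : ℤ) ^ (i + 1) = 2 * 2 ^ i := by ring
  have hd1 : (2 : ℤ) ^ (i + 1) ∣ (2 * m + 1) * 2 ^ (i + 1) := Dvd.intro_left _ rfl
  have hd2 : (2 : ℤ) ^ (i + 1) ∣ (2 * m + 1) * 2 ^ (i + 1) + 4 * 2 ^ i := ⟨2 * m + 3, by ring⟩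
  have hm1 := h.odd_mul_mem (k := m) dvd_rfl (by positivity) (by linarith) (by linarith)
  have e2 : (2 * (m + 1) + 1) * (2 : ℤ) ^ (i + 1) = (2 * m + 1) * 2 ^ (i + 1) + 4 * 2 ^ i := by ring
  have hm2 := h.odd_mul_mem (k := m + 1) dvd_rfl (by positivity) (by linarith) (by linarith)
  rw [e2] at hm2
  have ep : (2 * (2 * m + 1) + 1) * (2 : ℤ) ^ i = (2 * m + 1) * 2 ^ (i + 1) + 2 ^ i := by ring
  have hp := h.odd_mul_mem (d := 2 ^ i) (k := 2 * m + 1) (pow_dvd_pow 2 (by omega)) (by positivity)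
    (by linarith) (by linarith)
  rw [ep] at hp
  refine ⟨hp, ?_⟩
  have hpd : (2 : ℤ) ^ i ∣ (2 * m + 1) * 2 ^ (i + 1) + 2 ^ i := ⟨4 * m + 3, by ring⟩
  -- The separator lies 2^i to the right of the first candidate and 3·2^i to the left of the second,
  -- and its long side points to the right.
  have hcov : ∀ y, (2 * m + 1) * 2 ^ (i + 1) - 100 ≤ y →
      y ≤ (2 * m + 1) * 2 ^ (i + 1) + 4 * 2 ^ i + 100 →
      Covers ((2 * m + 1) * 2 ^ (i + 1) + 2 ^ i) y := by
    intro y hy1 hy2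
    refine Or.inr ⟨i, 2 * m + 1, ep.symm, ?_⟩
    rcases le_total ((2 * m + 1) * 2 ^ (i + 1) + 2 ^ i) y with hy | hy
    · exact Or.inr (Or.inl ⟨⟨m, rfl⟩, hy, by linarith⟩)
    · exact Or.inl ⟨by linarith, by linarith⟩
  obtain ⟨blk, hb⟩ := h.exists_arrangement hp
  obtain ⟨hbl, hbl'⟩ := h.left_bounds hb hLP
  obtain ⟨hbr, hbr'⟩ := h.right_bounds hb hRP
  have hheL := h.heavy_left hLP
  have hheR := h.heavy_right hRP
  set q : ℤ := (2 * m + 1) * 2 ^ (i + 1) with hqdef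
  refine hasPlacement_of_forall hb fun C hC => ?_
  have hcard : ((blk C).card : ℤ) = C.card := by exact_mod_cast hb.card C hC
  have hclass : 16 * 2 ^ i < 5 * (C.card : ℤ) → 2 * 2 ^ i < (blk C).card := by
    intro hh
    rw [hb.card C hC]
    have : 16 * 2 ^ i < 5 * C.card := by exact_mod_cast hh
    omega
  -- The separator may be a hole of level only i; the bushy end pieces tolerate it by
  -- `isReady_of_isBushy`.
  have hgi : GapsDvd (2 ^ i) (blk C) :=
    hb.gapsDvd (h.gaps.mono (pow_dvd_pow 2 (by omega))) hC (Or.inl hpd)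
  by_cases hCL : C = L
  · subst hCL
    obtain ⟨y₀, hy₀, hy₀'⟩ := exists_ge_add_card (h.blk_nonempty hb hC)
      (fun y hy => (h.mem_hull hb hC hy).2.1)
    have hq : q ∈ blk C := by
      obtain ⟨D, hD, hqD⟩ := hb.cover q (Finset.mem_erase.2 ⟨by linarith, hm1⟩)
      by_cases hDC : D = C
      · rwa [← hDC]
      · have := hbl D hD hDC q hqD
        linarith
    refine h.exists_embedding_of_isReady hb hC (w := q - 100) (isReady_of_isBushy h.three_le hgi
      (hclass hheL) (h.card_blk_le hb hC) hLb hq hd1 (by linarith) ⟨y₀, hy₀, by linarith⟩)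
      fun y hy hwy => hcov y hwy ?_
    linarith [hbr C hC h.ne y hy]
  by_cases hCR : C = R
  · subst hCR
    obtain ⟨y₀, hy₀, hy₀'⟩ := exists_le_sub_card (h.blk_nonempty hb hC)
      (fun y hy => (h.mem_hull hb hC hy).2.2)
    have hq : q + 4 * 2 ^ i ∈ blk C := by
      obtain ⟨D, hD, hqD⟩ := hb.cover (q + 4 * 2 ^ i)
        (Finset.mem_erase.2 ⟨fun heq => by linarith, hm2⟩)
      by_cases hDC : D = C
      · rwa [← hDC]
      · have := hbr D hD hDC _ hqD
        linarith
    refine h.exists_embedding_of_isReady_reflect hb hC (w := q + 4 * 2 ^ i + 100)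
      (isReady_of_isBushy h.three_le hgi.reflect (by rw [card_reflect]; exact hclass hheR)
      ((card_reflect _).trans_le (h.card_blk_le hb hC)) hRb
      (p := -(q + 4 * 2 ^ i)) (mem_reflect.2 (by rwa [neg_neg])) (hd2.neg_right) (by linarith)
      ⟨-y₀, mem_reflect.2 (by rwa [neg_neg]), by linarith⟩)
      fun y hy hwy => hcov y ?_ hwy
    linarith [hbl C hC h.ne.symm y hy]
  -- `L` extends beyond q + (8/5)·2^i, so the middle pieces lie to the right of the separator and
  -- acquire no hole there.
  · have hpos : ∀ u ∈ blk C, q + 2 ^ i < u := fun u hu => by linarith [hbl C hC hCL u hu]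
    have hg : GapsDvd (2 ^ (i + 1)) (blk C) :=
      hb.gapsDvd (h.gaps.mono (pow_dvd_pow 2 (by omega))) hC (Or.inr (Or.inr hpos))
    refine h.exists_embedding_of_covers hb hC hg (fun _ k lo hlo hi hhi h1 h2 => ?_)
      fun y hy => hcov y ?_ ?_
    · rcases h.eq_or_eq_of_extends hb hC hg hlo hhi h1 h2 with h0 | h0
      · exact absurd h0 hCL
      · exact absurd h0 hCR
    · linarith [hbl C hC hCL y hy]
    · linarith [hbr C hC hCR y hy]

/-- The separator of a wide block can always be placed. -/
theorem exists_hasPlacement (h : WideBlock T F x P L R J i a b) (hLR : L ∈ P ∨ R ∈ P)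
    (hL0 : L ∈ P ∨ L = ∅) (hR0 : R ∈ P ∨ R = ∅) :
    ∃ p ∈ J, HasPlacement T x P (endKey L R) J p ∧
      ∃ k : ℤ, (2 * k + 1) * 2 ^ (i + 1) ∈ J ∧ (2 * k + 1) * 2 ^ (i + 1) ≤ p := by
  obtain ⟨hlen, hlen', h8⟩ := h.length
  have hpow : (2 : ℤ) ^ (i + 1) = 2 * 2 ^ i := by ring
  have hdvd : ∀ k : ℤ, (2 : ℤ) ^ (i + 1) ∣ (2 * k + 1) * 2 ^ (i + 1) := fun k =>
    Dvd.intro_left _ rfl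
  have hmem : ∀ k : ℤ, a ≤ (2 * k + 1) * 2 ^ (i + 1) → (2 * k + 1) * 2 ^ (i + 1) ≤ b →
      (2 * k + 1) * 2 ^ (i + 1) ∈ J := fun k => h.odd_mul_mem dvd_rfl (by positivity)
  have hJ := h.card_le
  have hJ' := h.lt_card
  have hhL := h.half_left
  have hhR := h.half_right
  have hfull : ∀ k : ℤ, a ≤ (2 * k + 1) * 2 ^ (i + 1) → (2 * k + 1) * 2 ^ (i + 1) ≤ b →
      5 * ((2 * k + 1) * 2 ^ (i + 1) - a) ≤ 26 * 2 ^ i + 500 →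
      5 * (b - (2 * k + 1) * 2 ^ (i + 1)) ≤ 26 * 2 ^ i + 500 →
      LeftFine T L i a ((2 * k + 1) * 2 ^ (i + 1)) →
      RightFine T R i b ((2 * k + 1) * 2 ^ (i + 1)) →
      ∃ p ∈ J, HasPlacement T x P (endKey L R) J p ∧
        ∃ k : ℤ, (2 * k + 1) * 2 ^ (i + 1) ∈ J ∧ (2 * k + 1) * 2 ^ (i + 1) ≤ p := by
    intro k h1 h2 h3 h4 h5 h6
    refine ⟨_, hmem k h1 h2, h.hasPlacement_of_covers (hmem k h1 h2) (hdvd k) h5 h6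
      fun y hy => covers_of_dvd (hdvd k) ?_ ?_, k, hmem k h1 h2, le_rfl⟩
    · linarith [h.le_right y hy]
    · linarith [h.left_le y hy]
  obtain ⟨k, hk1, hk2⟩ := exists_odd_multiple_ge (h := 2 ^ (i + 1)) (by positivity) a
  have e1 : (2 * (k + 1) + 1) * (2 : ℤ) ^ (i + 1) = (2 * k + 1) * 2 ^ (i + 1) + 4 * 2 ^ i := by
    ring
  have e2 : (2 * (k + 2) + 1) * (2 : ℤ) ^ (i + 1) = (2 * k + 1) * 2 ^ (i + 1) + 8 * 2 ^ i := by
    ring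
  have hfull1 := hfull k
  have hfull2 := hfull (k + 1)
  have hmem1 := hmem k
  have hmem2 := hmem (k + 1)
  have hright := h.hasPlacement_of_right (m := k + 1)
  have hleft := h.hasPlacement_of_left (m := k)
  have hboth := h.hasPlacement_of_both (m := k)
  have hk2' : (2 * k + 1) * (2 : ℤ) ^ (i + 1) < a + 4 * 2 ^ i := by linarith
  clear hk2 hfull hmem
  rw [e1] at hfull2 hmem2 hright
  rw [add_sub_cancel_right] at hright
  set q : ℤ := (2 * k + 1) * 2 ^ (i + 1) with hq
  -- The candidates are 4·2^i apart, with reach (26/5)·2^i, in a hull of length about 8·2^i at most.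
  -- With one or three candidates a central one covers everything; two remain critical.
  rcases lt_or_ge b (q + 4 * 2 ^ i) with hb1 | hb1
  · refine hfull1 hk1 (by linarith) (by linarith) (by linarith) ?_ ?_
    · exact fun _ h1 h2 => by linarith
    · exact fun _ h1 h2 => by linarith
  rcases le_or_gt (q + 8 * 2 ^ i) b with hb2 | hb2
  · refine hfull2 (by linarith) hb1 (by linarith) (by linarith) ?_ ?_
    · exact fun _ h1 h2 => by linarith
    · exact fun _ h1 h2 => by linarith
  have hLq2 : LeftFine T L i a (q + 4 * 2 ^ i) := fun _ h1 h2 => by linarith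
  have hRq1 : RightFine T R i b q := fun _ h1 h2 => by linarith
  have hm1 := hmem1 hk1 (by linarith)
  have hm2 := hmem2 (by linarith) hb1
  have hne : ∀ C : Finset V, IsBushy T C i → C ≠ ∅ := by
    rintro C ⟨y, hy, -⟩ rfl
    simp at hy
  by_cases hbL : LeftFine T L i a q
  · by_cases hbR : RightFine T R i b (q + 4 * 2 ^ i)
    · by_cases hA : 5 * (b - q) ≤ 26 * 2 ^ i + 500
      · exact hfull1 hk1 (by linarith) (by linarith) hA hbL hRq1
      by_cases hB : 5 * (q + 4 * 2 ^ i - a) ≤ 26 * 2 ^ i + 500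
      · exact hfull2 (by linarith) hb1 hB (by linarith) hLq2 hbR
      -- Neither window contains `J`, so each overhang beyond the outer candidates exceeds (6/5)·2^i
      -- + 100; the total length then bounds both by (14/5)·2^i.
      rcases hLR with hLP | hRP
      · exact ⟨_, hm2, hleft hLP hm2 (by linarith) (by linarith) hbR, k, hm1, by linarith⟩
      · exact ⟨_, hm1, hright hRP hm1 (by linarith) (by linarith) hbL, k, hm1, le_rfl⟩
    -- `R` has at most about 4·2^i positions and extends (8/5)·2^i to the left of the second
    -- candidate, so the overhang on the right is at most (12/5)·2^i and the first candidate can be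
    -- used.
    · simp only [RightFine, not_forall, not_false_eq_true] at hbR
      obtain ⟨hRb, h1, h2, -⟩ := hbR
      have hRP := hR0.resolve_right (hne R hRb)
      exact ⟨_, hm1, hright hRP hm1 (by linarith) (by linarith) hbL, k, hm1, le_rfl⟩
  · simp only [LeftFine, not_forall, not_false_eq_true] at hbL
    obtain ⟨hLb, h1, h2, -⟩ := hbL
    have hLP := hL0.resolve_right (hne L hLb)
    by_cases hbR : RightFine T R i b (q + 4 * 2 ^ i)
    · exact ⟨_, hm2, hleft hLP hm2 (by linarith) (by linarith) hbR, k, hm1, by linarith⟩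
    · simp only [RightFine, not_forall, not_false_eq_true] at hbR
      obtain ⟨hRb, h3, h4, -⟩ := hbR
      have hRP := hR0.resolve_right (hne R hRb)
      obtain ⟨hp, hpl⟩ := hboth hLP hRP hLb hRb h1 h2 h3 h4
      exact ⟨_, hp, hpl, k, hm1, by linarith⟩

end WideBlock

end Embedding

/-! ### The induction. -/

section Embedding

variable {V : Type*} [DecidableEq V] {T : SimpleGraph V}

theorem linked_of_near {p q : ℤ} (h1 : q - p ≤ 100) (h2 : p - q ≤ 100) : Linked p q :=
  Or.inl (covers_of_dvd (j := 0) (by simp) (by linarith) (by linarith))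

/-- Positions at distance at most 100 are always linked, so any bijection taking `v` to `y` works.
-/
theorem exists_embedding_of_near {F : Finset V} {J : Finset ℤ} (hc : J.card = F.card)
    (hnear : ∀ u ∈ J, ∀ v ∈ J, v - u ≤ 100) {v : V} (hv : v ∈ F) {y : ℤ} (hy : y ∈ J) :
    ∃ f, IsEmbedding T F J f ∧ f v = y := by
  have hcard : (F.erase v).card = (J.erase y).card := by
    rw [Finset.card_erase_of_mem hv, Finset.card_erase_of_mem hy, hc]
  let e := Finset.equivOfCardEq hcard
  let f : V → ℤ := fun u => if h : u ∈ F.erase v then (e ⟨u, h⟩ : ℤ) else y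
  have hfv : f v = y := dif_neg (by simp)
  have hfu : ∀ u (h : u ∈ F.erase v), f u = e ⟨u, h⟩ := fun u h => dif_pos h
  have hmem : ∀ u ∈ F.erase v, f u ∈ J ∧ f u ≠ y := fun u h => by
    rw [hfu u h]
    have := Finset.mem_erase.1 (e ⟨u, h⟩).2
    exact ⟨this.2, this.1⟩
  have hmaps : ∀ u ∈ F, f u ∈ J := fun u hu => by
    by_cases huv : u = v
    · rw [huv, hfv]; exact hy
    · exact (hmem u (Finset.mem_erase.2 ⟨huv, hu⟩)).1
  refine ⟨f, ⟨hmaps, fun u hu w hw huw => ?_, fun u hu w hw _ => ?_⟩, hfv⟩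
  · by_cases huv : u = v <;> by_cases hwv : w = v
    · rw [huv, hwv]
    · have := (hmem w (Finset.mem_erase.2 ⟨hwv, hw⟩)).2
      rw [← huw, huv, hfv] at this
      exact absurd rfl this
    · have := (hmem u (Finset.mem_erase.2 ⟨huv, hu⟩)).2
      rw [huw, hwv, hfv] at this
      exact absurd rfl this
    · rw [hfu u (Finset.mem_erase.2 ⟨huv, hu⟩), hfu w (Finset.mem_erase.2 ⟨hwv, hw⟩)] at huw
      have := e.injective (Subtype.ext huw)
      simpa using this
  · exact linked_of_near (hnear _ (hmaps u hu) _ (hmaps w hw)) (hnear _ (hmaps w hw) _ (hmaps u hu))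

theorem IsSplit.card_lt {F : Finset V} {x : V} {P : Finset (Finset V)} (h : IsSplit T F x P)
    (hx : x ∈ F) {C : Finset V} (hC : C ∈ P) : C.card < F.card :=
  Finset.card_lt_card ⟨fun u hu => (h.subset C hC u hu).1, fun hF => (h.subset C hC x (hF hx)).2 rfl⟩

/-- A block with a bushy piece is filled by placing the centre of the piece at a position that
covers the block. -/
theorem exists_embedding_of_isBushy {F : Finset V} {J : Finset ℤ} {i : ℕ} {w p : ℤ} {x v : V}
    {P : Finset (Finset V)} (hP : IsSplit T F x P) (hx : x ∈ F) (hc : J.card = F.card) (hi : 3 ≤ i)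
    (hJ : J.card ≤ 4 * 2 ^ (i + 1)) (hg : GapsDvd (2 ^ (i + 1)) J)
    (hsmall : ∀ C ∈ P, 5 * C.card ≤ 8 * 2 ^ (i + 1))
    (hp : p ∈ J) (hpi : (2 : ℤ) ^ (i + 1) ∣ p) (hwp : w ≤ p) (hcov : ∀ y ∈ J, Covers p y)
    (hw : ∃ y ∈ J, 5 * w + 8 * 2 ^ (i + 1) + 50 ≤ 5 * y) (hv : v ∈ F)
    (ih : ∀ C ∈ P, ∀ B w v, B.card = C.card → v ∈ C → IsReady T C B w →
      ∃ f, IsEmbedding T C B f ∧ w ≤ f v) :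
    ∃ f, IsEmbedding T F J f ∧ w ≤ f v := by
  have h8 := eight_le_two_pow hi
  have hpow : (2 : ℤ) ^ (i + 1) = 2 * 2 ^ i := by ring
  have hpowN : 2 ^ (i + 1) = 2 * 2 ^ i := by ring
  have hJz : (J.card : ℤ) ≤ 4 * 2 ^ (i + 1) := by exact_mod_cast hJ
  have hne : J.Nonempty := ⟨p, hp⟩
  have main : ∀ R : Finset V, ∃ blk, IsArrangement P (J.erase p) (endKey ∅ R) blk ∧
      ∃ f, IsEmbedding T F J f ∧ f x = p ∧ ∀ C ∈ P, ∀ u ∈ C, f u ∈ blk C := by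
    intro R
    obtain ⟨blk, hb⟩ := exists_arrangement (endKey ∅ R) P (J.erase p) (by
      rw [hP.sum_card, Finset.card_erase_of_mem hp, Finset.card_erase_of_mem hx, hc])
    have hex : ∀ C ∈ P, ∃ g, IsEmbedding T C (blk C) g ∧ ∀ u ∈ C, T.Adj x u → Linked p (g u) := by
      intro C hC
      have hgC := hb.gapsDvd hg hC (Or.inl hpi)
      have hcC := hb.card C hC
      have hsC := hsmall C hC
      have hneC : (blk C).Nonempty := by
        rw [← Finset.card_pos, hcC, Finset.card_pos]
        exact hP.nonempty C hC
      obtain ⟨w', hw'⟩ := exists_isReady (T := T) (C := C) (by omega) hneC hgC (by omega)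
        (fun _ k lo hlo hi' hhi h1 h2 => by
          have hz : (5 : ℤ) * (blk C).card ≤ 8 * 2 ^ (i + 1) := by rw [hcC]; exact_mod_cast hsC
          have := hull_length_le (d := 2 ^ (i + 1)) (by linarith) hgC (by linarith) hlo hhi
          linarith)
      exact exists_linked_embedding (hP.nonempty C hC) (hP.unique C hC)
        (fun v hv => ih C hC _ w' v hcC hv hw')
        fun y hy _ => hcov y (Finset.mem_of_mem_erase (hb.subset C hC hy))
    choose! g hg using hex
    obtain ⟨f, hf, hfx, hfC⟩ := hP.exists_embedding hp hb (fun C hC => (hg C hC).1)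
      fun C hC => (hg C hC).2
    exact ⟨blk, hb, f, hf, hfx, fun C hC u hu => by
      rw [hfC C hC u hu]; exact (hg C hC).1.mapsTo u hu⟩
  by_cases hvx : v = x
  · obtain ⟨blk, -, f, hf, hfx, -⟩ := main ∅
    exact ⟨f, hf, by rwa [hvx, hfx]⟩
  -- The light piece of `v` is put at the right end, so `v` lands within about (8/5)·2^(i+1) of the
  -- maximum of `J`.
  · obtain ⟨D, hD, hvD⟩ := hP.cover v hv hvx
    obtain ⟨blk, hb, f, hf, -, hfC⟩ := main D
    refine ⟨f, hf, ?_⟩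
    obtain ⟨b, hbJ, hbmax⟩ := Finset.exists_max_image J id hne
    simp only [id] at hbmax
    have h1 := hb.sub_card_le (d := 2 ^ (i + 1)) (by linarith) hg hJz hbJ hbmax hD
      (hP.nonempty D hD).ne_empty.symm (hfC D hD v hvD)
    have h2 : (5 : ℤ) * D.card ≤ 8 * 2 ^ (i + 1) := by exact_mod_cast hsmall D hD
    obtain ⟨y, hy, hwy⟩ := hw
    linarith [hbmax y hy]

/-- The heavy pieces of a split can be put at the ends in such a way that the piece of a given
vertex is not at the left end. -/
theorem IsSplit.exists_ends {F : Finset V} {x v : V} {P : Finset (Finset V)} (hP : IsSplit T F x P)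
    {s : ℕ} (hF : F.card < 3 * s) (hheavy : ∃ C ∈ P, s ≤ C.card) :
    ∃ L R : Finset V, L ≠ R ∧ (L ∈ P ∨ R ∈ P) ∧ (L ∈ P ∨ L = ∅) ∧ (R ∈ P ∨ R = ∅) ∧
      (L ∈ P → s ≤ L.card) ∧ (R ∈ P → s ≤ R.card) ∧
      (∀ C ∈ P, s ≤ C.card → C = L ∨ C = R) ∧ v ∉ L ∧ (L ∈ P ∨ v ∈ R) := by
  obtain ⟨A, hA, hsA⟩ := hheavy
  have hnot : ∅ ∉ P := fun h => by simpa using hP.nonempty _ h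
  by_cases h2 : ∃ B ∈ P, s ≤ B.card ∧ B ≠ A
  · obtain ⟨B, hB, hsB, hBA⟩ := h2
    have hthird : ∀ C ∈ P, s ≤ C.card → C = A ∨ C = B := by
      intro C hC hsC
      by_contra! hcon
      have hsub : ({A, B, C} : Finset (Finset V)) ⊆ P := by
        intro D hD
        simp only [Finset.mem_insert, Finset.mem_singleton] at hD
        rcases hD with rfl | rfl | rfl <;> assumption
      have hsum := Finset.sum_le_sum_of_subset (f := Finset.card) hsub
      rw [hP.sum_card, Finset.sum_insert (by simp [hBA.symm, hcon.1.symm]),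
        Finset.sum_insert (by simp [hcon.2.symm]), Finset.sum_singleton] at hsum
      have := Finset.card_erase_le (s := F) (a := x)
      omega
    by_cases hvA : v ∈ A
    · refine ⟨B, A, hBA, Or.inl hB, Or.inl hB, Or.inl hA, fun _ => hsB, fun _ => hsA,
        fun C hC hs => (hthird C hC hs).symm, fun hvB => hBA (hP.disjoint B hB A hA v hvB hvA),
        Or.inl hB⟩
    · exact ⟨A, B, hBA.symm, Or.inl hA, Or.inl hA, Or.inl hB, fun _ => hsA, fun _ => hsB,
        hthird, hvA, Or.inl hA⟩
  · push Not at h2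
    by_cases hvA : v ∈ A
    · exact ⟨∅, A, (hP.nonempty A hA).ne_empty.symm, Or.inr hA, Or.inr rfl, Or.inl hA,
        fun h => absurd h hnot, fun _ => hsA, fun C hC hs => Or.inr (h2 C hC hs), by simp,
        Or.inr hvA⟩
    · exact ⟨A, ∅, (hP.nonempty A hA).ne_empty, Or.inl hA, Or.inl hA, Or.inr rfl,
        fun _ => hsA, fun h => absurd h hnot, fun C hC hs => Or.inl (h2 C hC hs), hvA,
        Or.inl hA⟩

theorem exists_embedding_of_not_isBushy (hT : T.IsAcyclic) {F : Finset V} {J : Finset ℤ} {i : ℕ}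
    {w : ℤ} {v : V} (hc : J.card = F.card) (hi : 3 ≤ i) (hJ : 2 * 2 ^ (i + 1) < J.card)
    (hJ' : J.card ≤ 4 * 2 ^ (i + 1)) (hg : GapsDvd (2 ^ (i + 2)) J)
    (hnb : ¬ IsBushy T F (i + 1)) (hw : ∀ y ∈ J, 5 * w + 50 ≤ 5 * y + 8 * 2 ^ (i + 1))
    (hw' : ∀ k : ℤ, (2 * k + 1) * 2 ^ (i + 1) ∈ J → w ≤ (2 * k + 1) * 2 ^ (i + 1)) (hv : v ∈ F)
    (ih : ∀ C : Finset V, C.card < F.card → ∀ B w v, B.card = C.card → v ∈ C → IsReady T C B w →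
      ∃ f, IsEmbedding T C B f ∧ w ≤ f v) :
    ∃ f, IsEmbedding T F J f ∧ w ≤ f v := by
  obtain ⟨x, hx, P, hP, hhalf⟩ := exists_centroid hT F ⟨v, hv⟩
  have hpowN : 2 ^ (i + 1) = 2 * 2 ^ i := by ring
  -- The threshold is the least integer above (16/5)·2^i = (8/5)·2^(i+1), the bound in `IsBushy`.
  -- Three heavy pieces would exceed |F| ≤ 8·2^i.
  have hheavy : ∃ C ∈ P, 16 * 2 ^ i / 5 + 1 ≤ C.card := by
    by_contra! hcon
    refine hnb ⟨x, hx, P, hP, fun C hC => ?_⟩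
    have := hcon C hC
    omega
  obtain ⟨L, R, hne, hLR, hL0, hR0, hsL, hsR, hall, hvL, hvR⟩ :=
    hP.exists_ends (v := v) (by omega) hheavy
  have hJne : J.Nonempty := Finset.card_pos.1 (by omega)
  obtain ⟨a, ha, hamin⟩ := Finset.exists_min_image J id hJne
  obtain ⟨b, hb, hbmax⟩ := Finset.exists_max_image J id hJne
  have hz : ∀ C : Finset V, 16 * 2 ^ i / 5 + 1 ≤ C.card → 16 * 2 ^ i < 5 * (C.card : ℤ) := by
    intro C hC
    have : 16 * 2 ^ i < 5 * C.card := by omega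
    exact_mod_cast this
  have hh : ∀ C, C ∈ P ∨ C = ∅ → 2 * (C.card : ℤ) ≤ J.card := by
    rintro C (hC | rfl)
    · rw [hc]
      exact_mod_cast hhalf C hC
    · simp
  have hwide : WideBlock T F x P L R J i a b :=
    { split := hP, mem := hx, card_eq := hc, gaps := hg, three_le := hi
      lt_card := by
        have : 4 * 2 ^ i < J.card := by omega
        exact_mod_cast this
      card_le := by
        have : J.card ≤ 8 * 2 ^ i := by omega
        exact_mod_cast this
      left_mem := ha, left_le := hamin, right_mem := hb, le_right := hbmax
      half := fun C hC => hh C (Or.inl hC)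
      half_left := hh L hL0
      half_right := hh R hR0
      heavy := fun C hC h => hall C hC (by
        have : 16 * 2 ^ i < 5 * C.card := by exact_mod_cast h
        omega)
      heavy_left := fun h => hz L (hsL h)
      heavy_right := fun h => hz R (hsR h)
      ne := hne
      embed := fun C hC => ih C (hP.card_lt hx hC) }
  obtain ⟨p, hp, ⟨blk, hblk, g, hgC⟩, k, hk, hkp⟩ := hwide.exists_hasPlacement hLR hL0 hR0
  obtain ⟨f, hf, hfx, hfC⟩ := hP.exists_embedding hp hblk (fun C hC => (hgC C hC).1)
    fun C hC => (hgC C hC).2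
  refine ⟨f, hf, ?_⟩
  by_cases hvx : v = x
  · rw [hvx, hfx]
    exact (hw' k hk).trans hkp
  obtain ⟨D, hD, hvD⟩ := hP.cover v hv hvx
  have hfv : f v ∈ blk D := by
    rw [hfC D hD v hvD]
    exact (hgC D hD).1.mapsTo v hvD
  have hwa := hw a ha
  have hpow : (2 : ℤ) ^ (i + 1) = 2 * 2 ^ i := by ring
  obtain ⟨hlen, hlen', h8⟩ := hwide.length
  -- If `L` is heavy, `v` comes after its more than (16/5)·2^i positions. Otherwise `v` is in `R`,
  -- which occupies at most the last half of `J`, up to the holes.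
  by_cases hLP : L ∈ P
  · have h1 := (hwide.left_bounds hblk hLP).1 D hD (fun h => hvL (h ▸ hvD)) _ hfv
    linarith [hz L (hsL hLP)]
  · have hRP := hLR.resolve_left hLP
    have hDR : D = R := hP.disjoint D hD R hRP v hvD (hvR.resolve_left hLP)
    subst hDR
    have h1 := (hwide.right_bounds hblk hRP).2 _ hfv
    linarith [hz D (hsR hRP), hwide.half_right]

/-- A piece can be embedded into a ready block. -/
theorem exists_embedding_of_isReady (hT : T.IsAcyclic) (F : Finset V) (J : Finset ℤ) (w : ℤ) (v : V)
    (hc : J.card = F.card) (hv : v ∈ F) (h : IsReady T F J w) :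
    ∃ f, IsEmbedding T F J f ∧ w ≤ f v := by
  induction hn : F.card using Nat.strong_induction_on generalizing F J w v with
  | _ n ih =>
    subst hn
    have ih' : ∀ C : Finset V, C.card < F.card → ∀ B w v, B.card = C.card → v ∈ C →
        IsReady T C B w → ∃ f, IsEmbedding T C B f ∧ w ≤ f v :=
      fun C hC B w v hBC hvC hr => ih _ hC C B w v hBC hvC hr rfl
    rcases h with ⟨-, hnear, y, hy, hwy⟩ | ⟨e, he, hJ, hJ', h⟩
    · obtain ⟨f, hf, hfv⟩ := exists_embedding_of_near (T := T) hc hnear hv hy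
      exact ⟨f, hf, by rwa [hfv]⟩
    · obtain ⟨i, rfl⟩ : ∃ i, e = i + 1 := Nat.exists_eq_succ_of_ne_zero (by omega)
      rcases h with ⟨hnb, hg, hw, hw'⟩ |
        ⟨hg, ⟨x, hx, P, hP, hsmall⟩, ⟨p, hp, hpi, hwp, hcov⟩, hw⟩
      · exact exists_embedding_of_not_isBushy hT hc (by omega) hJ hJ' hg hnb hw hw' hv ih'
      · exact exists_embedding_of_isBushy hP hx hc (by omega) hJ' hg hsmall hp hpi hwp hcov hw hv
          fun C hC => ih' C (hP.card_lt hx hC)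

/-- Every forest on `n` vertices embeds into the linked positions among `1, …, n`. -/
theorem exists_embedding_Icc (hT : T.IsAcyclic) (F : Finset V) (hF : F.Nonempty) :
    ∃ f, IsEmbedding T F (Finset.Icc (1 : ℤ) F.card) f := by
  have hcard : (Finset.Icc (1 : ℤ) F.card).card = F.card := by simp
  have hlt : F.card < 2 ^ F.card := Nat.lt_two_pow_self
  have hgap : ∀ lo ∈ Finset.Icc (1 : ℤ) F.card, ∀ hi ∈ Finset.Icc (1 : ℤ) F.card, ∀ z, lo ≤ z →
      z ≤ hi → z ∈ Finset.Icc (1 : ℤ) F.card := by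
    intro lo hlo hi hhi z h1 h2
    rw [Finset.mem_Icc] at *
    omega
  -- An interval has no holes, so an arbitrarily large `i` is allowed; |F| + 2 makes the size bound
  -- trivial.
  obtain ⟨w, hw⟩ := exists_isReady (T := T) (C := F) (B := Finset.Icc (1 : ℤ) F.card)
    (i := F.card + 2) (by omega)
    (by rw [← Finset.card_pos, hcard]; exact Finset.card_pos.2 hF)
    (fun lo hlo hi hhi z h1 h2 hz => absurd (hgap lo hlo hi hhi z h1 h2) hz)
    (by rw [hcard, pow_add]; omega)
    (fun _ k lo hlo hi hhi h1 h2 => by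
      have : (0 : ℤ) < 2 ^ (F.card + 2) := by positivity
      exact hgap lo hlo hi hhi _ (by linarith) (by linarith))
  obtain ⟨v, hv⟩ := hF
  obtain ⟨f, hf, -⟩ := exists_embedding_of_isReady hT F _ w v hcard hv hw
  exact ⟨f, hf⟩

end Embedding

/-! ### The universal graph and its number of edges. -/

/-- The linked positions among `1, …, n`, as a graph on `Fin n`. -/
def windowGraph (n : ℕ) : SimpleGraph (Fin n) where
  Adj i j := i ≠ j ∧ Linked ((i : ℤ) + 1) ((j : ℤ) + 1)
  symm := ⟨fun _ _ h => ⟨h.1.symm, h.2.symm⟩⟩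
  loopless := ⟨fun _ h => h.1 rfl⟩

theorem isUniversalFor_windowGraph (n : ℕ) : IsUniversalFor (windowGraph n) (treeFamily n) := by
  intro T hT
  have hT' : T.IsTree := hT
  have : Nonempty (Fin n) := hT'.1.nonempty
  obtain ⟨f, hf⟩ := exists_embedding_Icc hT'.2 Finset.univ Finset.univ_nonempty
  rw [Finset.card_univ, Fintype.card_fin] at hf
  have hmem : ∀ u, 1 ≤ f u ∧ f u ≤ n := fun u => Finset.mem_Icc.1 (hf.mapsTo u (Finset.mem_univ u))
  let g : Fin n → Fin n := fun u => ⟨(f u - 1).toNat, by have := hmem u; omega⟩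
  have hg : ∀ u, ((g u : ℕ) : ℤ) + 1 = f u := fun u => by
    have := hmem u
    simp only [g]
    omega
  have hinj : Function.Injective g := fun u v huv => by
    refine hf.injOn u (Finset.mem_univ u) v (Finset.mem_univ v) ?_
    rw [← hg u, ← hg v, huv]
  refine ⟨⟨⟨g, fun {u v} huv => ⟨fun h => huv.ne (hinj h), ?_⟩⟩, hinj⟩⟩
  rw [hg u, hg v]
  exact hf.linked u (Finset.mem_univ u) v (Finset.mem_univ v) huv

/-- The positions covered by `(2 * k + 1) * 2 ^ e`. -/
noncomputable def windowAt (e k : ℕ) : Finset ℤ :=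
  if Odd k then
    Finset.Icc ((2 * k + 1) * 2 ^ e - (13 * 2 ^ e + 500) / 5) ((2 * k + 1) * 2 ^ e + 3 * 2 ^ e + 100)
  else
    Finset.Icc ((2 * k + 1) * 2 ^ e - 3 * 2 ^ e - 100) ((2 * k + 1) * 2 ^ e + (13 * 2 ^ e + 500) / 5)

/-- The two sides contribute 13/5 + 3 = 28/5; the constant is 5·(100 + 100 + 1). -/
theorem card_windowAt_le (e k : ℕ) : 5 * (windowAt e k).card ≤ 28 * 2 ^ e + 1005 := by
  unfold windowAt
  have h2 : (((2 : ℕ) ^ e : ℕ) : ℤ) = 2 ^ e := by push_cast; rfl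
  split_ifs <;> rw [Int.card_Icc] <;> omega

/-- Pairs of a position in `1, …, n` and a position covered by it. -/
noncomputable def coveredPairs (n : ℕ) : Finset (ℤ × ℤ) :=
  (Finset.range (Nat.log 2 n + 1)).biUnion fun e =>
    (Finset.range (n / 2 ^ (e + 1) + 1)).biUnion fun k =>
      (windowAt e k).image fun y => ((2 * k + 1) * 2 ^ e, y)

theorem mem_coveredPairs {n : ℕ} {p y : ℤ} (hp : 1 ≤ p) (hpn : p ≤ n) (h : Covers p y) :
    (p, y) ∈ coveredPairs n := by
  rcases h with rfl | ⟨e, k, hk, h⟩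
  · omega
  have hpos : (0 : ℤ) < 2 ^ e := by positivity
  have hk0 : 0 ≤ k := by
    by_contra hneg
    have : (2 * k + 1) * (2 : ℤ) ^ e ≤ 0 :=
      mul_nonpos_of_nonpos_of_nonneg (by omega) hpos.le
    omega
  lift k to ℕ using hk0
  have hpN : (2 * k + 1) * 2 ^ e ≤ n := by
    have : (2 * (k : ℤ) + 1) * 2 ^ e ≤ n := hk ▸ hpn
    exact_mod_cast this
  simp only [coveredPairs, Finset.mem_biUnion, Finset.mem_range, Finset.mem_image]
  refine ⟨e, ?_, k, ?_, y, ?_, by rw [hk]⟩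
  · have h1 : 2 ^ e ≤ n := le_trans (by nlinarith [Nat.zero_le (2 ^ e)]) hpN
    have := Nat.le_log_of_pow_le (by norm_num) h1
    omega
  · rw [Nat.lt_succ_iff, Nat.le_div_iff_mul_le (by positivity), pow_succ]
    nlinarith [Nat.zero_le (2 ^ e)]
  · unfold windowAt
    rw [← hk]
    rcases h with ⟨h1, h2⟩ | ⟨hodd, h1, h2⟩ | ⟨heven, h1, h2⟩
    · split_ifs <;> rw [Finset.mem_Icc] <;> omega
    · rw [if_pos (by exact_mod_cast hodd), Finset.mem_Icc]
      omega
    · rw [if_neg (by rw [Nat.not_odd_iff_even]; exact_mod_cast heven), Finset.mem_Icc]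
      omega

theorem ncard_edgeSet_windowGraph_le (n : ℕ) :
    (windowGraph n).edgeSet.ncard ≤ (coveredPairs n).card := by
  classical
  let φ : Sym2 (Fin n) → Sym2 ℤ := Sym2.map fun i => (i : ℤ) + 1
  have hφ : Function.Injective φ := Sym2.map.injective fun i j hij => by
    have : (i : ℤ) = j := by simpa using hij
    exact Fin.ext (by exact_mod_cast this)
  have hmem : ∀ s ∈ (windowGraph n).edgeSet,
      φ s ∈ ((coveredPairs n).image fun q => s(q.1, q.2) : Finset (Sym2 ℤ)) := by
    intro s
    refine Sym2.ind (fun i j hij => ?_) s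
    rw [SimpleGraph.mem_edgeSet] at hij
    rw [Finset.mem_image]
    rcases hij.2 with h | h
    · exact ⟨(_, _), mem_coveredPairs (by omega) (by have := i.2; omega) h, rfl⟩
    · exact ⟨(_, _), mem_coveredPairs (by omega) (by have := j.2; omega) h, Sym2.eq_swap⟩
  have h1 := Set.ncard_le_ncard_of_injOn φ hmem hφ.injOn (Finset.finite_toSet _)
  rw [Set.ncard_coe_finset] at h1
  exact h1.trans Finset.card_image_le

theorem card_coveredPairs_le {n : ℕ} (hn : 1 ≤ n) :
    ((coveredPairs n).card : ℝ) ≤ 14 / 5 * n * Nat.log 2 n + 420 * n := by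
  have hterm : ∀ e : ℕ, (5 : ℝ) * (((Finset.range (n / 2 ^ (e + 1) + 1)).biUnion fun k =>
      (windowAt e k).image fun y => (((2 * k + 1) * 2 ^ e : ℤ), y)).card : ℝ) ≤
      14 * n + 28 * 2 ^ e + 1005 * (n / 2 ^ (e + 1)) + 1005 := by
    intro e
    have h1 := Finset.card_biUnion_le_card_mul (Finset.range (n / 2 ^ (e + 1) + 1))
      (fun k => (windowAt e k).image fun y => (((2 * k + 1) * 2 ^ e : ℤ), y))
      ((28 * 2 ^ e + 1005) / 5) (fun k _ => Finset.card_image_le.trans (by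
        have := card_windowAt_le e k
        omega))
    rw [Finset.card_range] at h1
    have h2 : (((28 * 2 ^ e + 1005) / 5 : ℕ) : ℝ) ≤ (28 * 2 ^ e + 1005) / 5 := by
      have := @Nat.cast_div_le ℝ _ _ _ (28 * 2 ^ e + 1005) 5
      push_cast at this
      exact this
    have h3 : ((n / 2 ^ (e + 1) : ℕ) : ℝ) ≤ n / 2 ^ (e + 1) := by
      have := @Nat.cast_div_le ℝ _ _ _ n (2 ^ (e + 1))
      push_cast at this
      exact this
    have hpos : (0 : ℝ) < 2 ^ e := by positivity
    have h4 : (n : ℝ) / 2 ^ (e + 1) * 2 ^ e = n / 2 := by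
      rw [pow_succ]; field_simp
    calc (5 : ℝ) * (((Finset.range (n / 2 ^ (e + 1) + 1)).biUnion fun k =>
          (windowAt e k).image fun y => (((2 * k + 1) * 2 ^ e : ℤ), y)).card : ℝ)
        ≤ 5 * (((n / 2 ^ (e + 1) : ℕ) + 1) * (((28 * 2 ^ e + 1005) / 5 : ℕ) : ℝ)) := by
          gcongr
          exact_mod_cast h1
      _ ≤ 5 * ((n / 2 ^ (e + 1) + 1) * ((28 * 2 ^ e + 1005) / 5)) := by gcongr
      _ = 28 * ((n : ℝ) / 2 ^ (e + 1) * 2 ^ e) + 28 * 2 ^ e + 1005 * (n / 2 ^ (e + 1)) + 1005 := by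
          ring
      _ = _ := by rw [h4]; ring
  have hsum : ∀ m : ℕ, ∑ e ∈ Finset.range m,
      ((14 : ℝ) * n + 28 * 2 ^ e + 1005 * (n / 2 ^ (e + 1)) + 1005) =
      14 * n * m + 28 * (2 ^ m - 1) + 1005 * (n - n / 2 ^ m) + 1005 * m := by
    intro m
    induction m with
    | zero => simp
    | succ m ih =>
      rw [Finset.sum_range_succ, ih, pow_succ]
      push_cast
      field_simp
      ring
  have hE : (2 : ℝ) ^ Nat.log 2 n ≤ n := by
    exact_mod_cast Nat.pow_log_le_self 2 (by omega)
  have hEn : (Nat.log 2 n : ℝ) + 1 ≤ n := by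
    have : Nat.log 2 n < n := Nat.log_lt_self 2 (by omega)
    exact_mod_cast this
  have hn' : (1 : ℝ) ≤ n := by exact_mod_cast hn
  have h5 : (5 : ℝ) * (coveredPairs n).card ≤ ∑ e ∈ Finset.range (Nat.log 2 n + 1),
      ((14 : ℝ) * n + 28 * 2 ^ e + 1005 * (n / 2 ^ (e + 1)) + 1005) := by
    refine le_trans ?_ (Finset.sum_le_sum fun e _ => hterm e)
    rw [← Finset.mul_sum]
    have : (coveredPairs n).card ≤ _ := Finset.card_biUnion_le
    gcongr
    exact_mod_cast this
  rw [hsum, pow_succ] at h5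
  push_cast at h5
  have hq : (0 : ℝ) ≤ n / (2 ^ Nat.log 2 n * 2) := by positivity
  -- Since 2^(log n) ≤ n and log n + 1 ≤ n, the error terms are at most (14 + 56 + 1005 + 1005)n =
  -- 2080n, below 5·420n.
  nlinarith

theorem theorem1 :
    ∃ C : ℝ, ∀ n : ℕ,
      (minUniversalEdges n : ℝ) ≤ 14 / 5 * (n : ℝ) * Real.logb 2 (n : ℝ) + C * (n : ℝ) := by
  refine ⟨420, fun n => ?_⟩
  have h1 : minUniversalEdges n ≤ (windowGraph n).edgeSet.ncard :=
    (isLeast_minUniversalEdges n).2 ⟨_, isUniversalFor_windowGraph n, rfl⟩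
  rcases Nat.eq_zero_or_pos n with rfl | hn
  · have h0 : (windowGraph 0).edgeSet.ncard = 0 := by
      rw [Set.ncard_eq_zero]
      exact Set.eq_empty_of_isEmpty _
    have : minUniversalEdges 0 = 0 := by omega
    simp [this]
  · have h2 : (minUniversalEdges n : ℝ) ≤ (coveredPairs n).card := by
      exact_mod_cast h1.trans (ncard_edgeSet_windowGraph_le n)
    have h3 : (Nat.log 2 n : ℝ) ≤ Real.logb 2 n := Real.natLog_le_logb n 2
    have h4 := card_coveredPairs_le hn
    have h5 : 14 / 5 * (n : ℝ) * Nat.log 2 n ≤ 14 / 5 * n * Real.logb 2 n := by gcongr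
    linarith
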